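/- Conventions. A structured matrix $\bar M\in\{0,*\}^{n_1\times n_2}$ has entries that are fixed zeros or independent free real parameters; $n_{\bar M}$ is the number of $*$ entries and a realization is given by $\theta\in\mathbb R^{n_{\bar M}}$. A proper variety is a real algebraic variety that is not the whole space. A real triple $(A,C,F)$ is functionally observable if, for $\dot x=Ax+Bu$, $y=Cx$, for every initial state $x(0)$ and input $u$ there is a finite time $T$ such that $Fx(0)$ is uniquely determined by $y$ and $u$ on $[0,T]$. $(\bar A,\bar C,\bar F)$ is structurally functionally observable (SFO) if all its realizations outside some proper variety of the parameter space are functionally observable. $\bar A$ is generically diagonalizable if all its realizations outside some proper variety are diagonalizable (over $\mathbb C$). $O(A,C)=\mathrm{col}\{C,CA,\dots,CA^{n-1}\}$, and $\mathrm{grank}$ is the maximal rank over all realizations. Let $X=\{x_1,\dots,x_n\}$, let $X_F$ (resp. $X_C$) be the set of $x_i$ such that the $i$th column of $\bar F$ (resp. $\bar C$) is nonzero, and $\bar I_n$ the $n\times n$ structured matrix with $*$ exactly on the diagonal. $\mathcal G(\bar A)$ is the digraph on $X$ with edges $E_{XX}=\{(x_i,x_j):\bar A_{ji}\neq0\}$.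 Given $\bar A\in\{0,*\}^{n\times n}$ and $\bar F\in\{0,*\}^{r\times n}$ with $\bar F\ne 0$, problem $\mathcal P_1$ asks for a matrix $\bar C\in\{0,*\}^{p\times n}$ ($p$ arbitrary) with the least number $p$ of rows such that $(\bar A,\bar C,\bar F)$ is SFO (such $\bar C$ are called feasible). Algorithm 2. Start with $\bar C$ having no rows. While $\mathrm{grank}\,O(\bar A,[\bar C;\bar F])-\mathrm{grank}\,O(\bar A,\bar C)\ge1$, append to $\bar C$ the row $\eta$ with $\eta_i=*$ if and only if $x_i\in X_F$. Return $\bar C$. Algorithm 3. Let $q=|X_F|$, let $Y$ consist of one output vertex $y$ for each element of $X_F$, and let $E_{XY}$ join each element of $X_F$ to its output vertex. Consider the bipartite graph both of whose parts are copies of $X\cup Y$, with edges $E_{XX}\cup E_{XY}\cup\{(v,v):v\in X\cup Y\}\cup (Y\times X)$, where an edge $(v,w)$ joins $v$ in the one part to $w$ in the other. An edge $(x_i,x_j)\in E_{XX}$ such that $x_j$ has a path to $Y$ in the digraph $(X\cup Y,E_{XX}\cup E_{XY})$ costs $q+1$, an edge in $E_{XY}$ costs $q$, and all other edges cost $0$.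 Take a matching $\mathcal H^*$ of maximum weight among the matchings of maximum size. Let $X_{\mathcal H^*}=\{x_i:(x_i,y)\in\mathcal H^*,\ y\in Y\}$ and $\gamma=\max\{1,|X_{\mathcal H^*}|\}$. Construct a $\gamma\times n$ matrix $\bar C$ by $\bar C_{ki}=*$ if $x_i$ is the $k$th element (in any order) of $X_{\mathcal H^*}$; then for each $x_j\in X_F\setminus X_{\mathcal H^*}$ from which no element of $X_{\mathcal H^*}$ is reachable in $\mathcal G(\bar A)$, choose one $i\in\{1,\dots,\gamma\}$ and set $\bar C_{ij}=*$; all other entries are $0$. Return $\bar C$. Theorem. Algorithms 2 and 3 both terminate and return a matrix, and every matrix $\bar C$ that either of them returns (for any choices made in Algorithm 3) is feasible for $\mathcal P_1$, satisfies $X_C\subseteq X_F$, and has the minimum number of rows among all feasible $\bar C'$ with $X_{C'}\subseteq X_F$. Moreover, if $\bar A$ is generically diagonalizable or $\bar F=\bar I_n$, then $\bar C$ is optimal for $\mathcal P_1$, i.e. has the minimum number of rows among all feasible matrices. -/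

import Mathlib

open scoped Matrix

noncomputable section

namespace StructSys

/-- A structured matrix in `{0,*}^{m × n}`: `true` marks a free entry `*`, `false` a fixed zero. -/
abbrev StructMat (m n : Type) : Type := Matrix m n Bool

/-- The positions of the free entries of a structured matrix. -/
abbrev Param {m n : Type} (M : StructMat m n) : Type := {e : m × n // M e.1 e.2 = true}

/-- The realization of `M` given by the values `θ` of its free entries. -/
def realize {m n : Type} (M : StructMat m n) (θ : Param M → ℝ) : Matrix m n ℝ :=
  fun i j => if h : M i j = true then θ ⟨(i, j), h⟩ else 0

/-- The indices of the nonzero columns of a structured matrix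
(`X_F` for `F`, the functional states, and `X_C` for `C`). -/
def nonzeroCols {m n : Type} [Fintype m] [Fintype n] (M : StructMat m n) : Finset n :=
  Finset.univ.filter fun j => ∃ i, M i j = true

/-- A proper algebraic variety in the real affine space with coordinates indexed by `σ`. -/
def IsProperVariety {σ : Type} (V : Set (σ → ℝ)) : Prop :=
  (∃ I : Ideal (MvPolynomial σ ℝ), V = MvPolynomial.zeroLocus ℝ I) ∧ V ≠ Set.univ

/-! Functional observability of a numerical system -/

/-- `x` is a (Carathéodory) solution on `[0, ∞)` of `x' = A x + B u`. -/
structure IsTrajectory {n m : ℕ} (A : Matrix (Fin n) (Fin n) ℝ) (B : Matrix (Fin n) (Fin m) ℝ)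
    (u : ℝ → Fin m → ℝ) (x : ℝ → Fin n → ℝ) : Prop where
  continuousOn : ContinuousOn x (Set.Ici 0)
  eq_integral : ∀ t : ℝ, 0 ≤ t → x t = x 0 + ∫ s in (0 : ℝ)..t, (A *ᵥ x s + B *ᵥ u s)

/-- The triple `(A, C, F)` is functionally observable: whatever the input matrix `B`, for every
locally integrable input `u` and every trajectory `x` (that is, every initial state) there is a
finite time `T` such that `F x(0)` is uniquely determined by the input `u` and by the output `C x`
on `[0, T]`. -/
def FunctionallyObservable {n p r : ℕ} (A : Matrix (Fin n) (Fin n) ℝ)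
    (C : Matrix (Fin p) (Fin n) ℝ) (F : Matrix (Fin r) (Fin n) ℝ) : Prop :=
  ∀ (m : ℕ) (B : Matrix (Fin n) (Fin m) ℝ) (u : ℝ → Fin m → ℝ),
    (∀ t : ℝ, 0 ≤ t → IntervalIntegrable u MeasureTheory.volume 0 t) →
    ∀ x : ℝ → Fin n → ℝ, IsTrajectory A B u x →
      ∃ T : ℝ, 0 < T ∧ ∀ x' : ℝ → Fin n → ℝ, IsTrajectory A B u x' →
        (∀ t ∈ Set.Icc 0 T, C *ᵥ x' t = C *ᵥ x t) → F *ᵥ x' 0 = F *ᵥ x 0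

/-- Structural functional observability: all realizations of `(A, C, F)` outside some proper
variety of the parameter space are functionally observable. -/
def IsSFO {n p r : ℕ} (A : StructMat (Fin n) (Fin n)) (C : StructMat (Fin p) (Fin n))
    (F : StructMat (Fin r) (Fin n)) : Prop :=
  ∃ V : Set (Param A ⊕ Param C ⊕ Param F → ℝ), IsProperVariety V ∧
    ∀ θ, θ ∉ V →
      FunctionallyObservable (realize A fun a => θ (Sum.inl a))
        (realize C fun c => θ (Sum.inr (Sum.inl c)))
        (realize F fun f => θ (Sum.inr (Sum.inr f)))

/-- A real square matrix is diagonalizable (over `ℂ`). -/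
def Diagonalizable {n : ℕ} (A : Matrix (Fin n) (Fin n) ℝ) : Prop :=
  ∃ (P : Matrix (Fin n) (Fin n) ℂ) (d : Fin n → ℂ), IsUnit P ∧
    A.map Complex.ofReal * P = P * Matrix.diagonal d

/-- All realizations of `A` outside some proper variety are diagonalizable. -/
def GenericallyDiagonalizable {n : ℕ} (A : StructMat (Fin n) (Fin n)) : Prop :=
  ∃ V : Set (Param A → ℝ), IsProperVariety V ∧ ∀ θ, θ ∉ V → Diagonalizable (realize A θ)

/-- The structured matrix with free diagonal and zero off-diagonal entries. -/
def structId (n : ℕ) : StructMat (Fin n) (Fin n) := fun i j => decide (i = j)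

/-- The structured matrix whose rows are the unit patterns `e_i`, `i ∈ S`. -/
def structIdOn {n : ℕ} (S : Finset (Fin n)) : StructMat {i // i ∈ S} (Fin n) :=
  fun i j => decide (i.1 = j)

/-! The iterative algorithm -/

/-- The observability matrix `col {C, C A, …, C A ^ (n - 1)}`. -/
def obsMatrix {n : ℕ} {m : Type} (A : Matrix (Fin n) (Fin n) ℝ) (C : Matrix m (Fin n) ℝ) :
    Matrix (Fin n × m) (Fin n) ℝ :=
  fun ki j => (C * A ^ (ki.1 : ℕ)) ki.2 j

/-- The generic rank of `O(A, C)`: the maximal rank over all realizations of `(A, C)`. The ranks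
are at most `n`, so that the supremum is attained. -/
def grankObs {n : ℕ} {m : Type} (A : StructMat (Fin n) (Fin n)) (C : StructMat m (Fin n)) : ℕ :=
  ⨆ θ : Param A ⊕ Param C → ℝ,
    (obsMatrix (realize A fun a => θ (Sum.inl a)) (realize C fun c => θ (Sum.inr c))).rank

/-- The loop condition `grank O(A, [C; F]) - grank O(A, C) ≥ 1`. -/
def LoopGuard {n p r : ℕ} (A : StructMat (Fin n) (Fin n)) (F : StructMat (Fin r) (Fin n))
    (C : StructMat (Fin p) (Fin n)) : Prop :=
  (1 : ℤ) ≤ (grankObs A (Matrix.fromRows C F) : ℤ) - (grankObs A C : ℤ)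

/-- The row `η` with `η_i = *` if and only if `x_i` is a functional state. -/
def eta {n r : ℕ} (F : StructMat (Fin r) (Fin n)) : Fin n → Bool :=
  fun i => decide (i ∈ nonzeroCols F)

/-- The matrix after `k` passes through the loop: start from the matrix without rows and append
the row `η` in each pass. -/
def loopState {n r : ℕ} (F : StructMat (Fin r) (Fin n)) : (k : ℕ) → StructMat (Fin k) (Fin n)
  | 0 => fun i => Fin.elim0 i
  | k + 1 => Matrix.of (Fin.snoc (α := fun _ => Fin n → Bool) (loopState F k) (eta F))

/-- The iterative algorithm with data `A, F` terminates and returns `C`: the loop condition holds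
in every earlier pass and fails for `C`. -/
def IterativeReturns {n p r : ℕ} (A : StructMat (Fin n) (Fin n)) (F : StructMat (Fin r) (Fin n))
    (C : StructMat (Fin p) (Fin n)) : Prop :=
  C = loopState F p ∧ ¬ LoopGuard A F C ∧ ∀ k < p, LoopGuard A F (loopState F k)

/-! Graphs and matchings -/

/-- The edges of the digraph `G(A, C)` on the state vertices and the output vertices. -/
def sysEdge {n : ℕ} {m : Type} (A : StructMat (Fin n) (Fin n)) (C : StructMat m (Fin n)) :
    Fin n ⊕ m → Fin n ⊕ m → Prop
  | Sum.inl i, Sum.inl j => A j i = true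
  | Sum.inl i, Sum.inr y => C y i = true
  | Sum.inr _, _ => False

/-- There is a path (possibly of length zero) from `x_i` to `x_j` in `G(A)`. -/
def StateReach {n : ℕ} (A : StructMat (Fin n) (Fin n)) (i j : Fin n) : Prop :=
  Relation.ReflTransGen (fun a b => A b a = true) i j

/-- The state vertex `x_i` is output-reachable in `G(A, C)`. -/
def OutputReachable {n : ℕ} {m : Type} (A : StructMat (Fin n) (Fin n)) (C : StructMat m (Fin n))
    (i : Fin n) : Prop :=
  ∃ y : m, Relation.ReflTransGen (sysEdge A C) (Sum.inl i) (Sum.inr y)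

/-- A matching of the bipartite graph with edges `E`, whose two parts are copies of `V` (an edge
`(v, w)` joins `v` in the right part to `w` in the left part). -/
def IsMatching {V : Type} (E : V → V → Prop) (H : Finset (V × V)) : Prop :=
  (∀ e ∈ H, E e.1 e.2) ∧
    ∀ e ∈ H, ∀ f ∈ H, (e.1 = f.1 ∨ e.2 = f.2) → e = f

/-- A matching of the largest size. -/
def IsMaximumMatching {V : Type} (E : V → V → Prop) (H : Finset (V × V)) : Prop :=
  IsMatching E H ∧ ∀ H', IsMatching E H' → H'.card ≤ H.card

/-- A maximum matching of the largest weight among all maximum matchings. -/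
def IsMaxWeightMaximumMatching {V : Type} (E : V → V → Prop) (w : V × V → ℕ)
    (H : Finset (V × V)) : Prop :=
  IsMaximumMatching E H ∧ ∀ H', IsMaximumMatching E H' → ∑ e ∈ H', w e ≤ ∑ e ∈ H, w e

/-! The matching based algorithm -/

/-- The vertices `X ∪ Y` of `G(A, I_S)`, with one output vertex for each element of `S`. -/
abbrev AugVertex {n : ℕ} (S : Finset (Fin n)) : Type := Fin n ⊕ {i // i ∈ S}

/-- The edges of the augmented bipartite graph: those of `G(A, I_S)`, a loop at each vertex, and
an edge from each output vertex to each state vertex. -/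
def augEdge {n : ℕ} (A : StructMat (Fin n) (Fin n)) (S : Finset (Fin n)) (v w : AugVertex S) :
    Prop :=
  sysEdge A (structIdOn S) v w ∨ v = w ∨ ∃ y i, v = Sum.inr y ∧ w = Sum.inl i

open Classical in
/-- The edge costs: with `q = |S|`, the cost is `q + 1` on the state edges that end in an
output-reachable state vertex of `G(A, I_S)`, `q` on the edges from states to outputs, and `0` on
all other edges. -/
def augCost {n : ℕ} (A : StructMat (Fin n) (Fin n)) (S : Finset (Fin n)) :
    AugVertex S × AugVertex S → ℕ
  | (Sum.inl i, Sum.inl j) =>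
      if A j i = true ∧ OutputReachable A (structIdOn S) j then S.card + 1 else 0
  | (Sum.inl i, Sum.inr y) => if structIdOn S y i = true then S.card else 0
  | (Sum.inr _, _) => 0

/-- The state vertices that `H` joins to output vertices. -/
def matchedToOutput {n : ℕ} {S : Finset (Fin n)} (H : Finset (AugVertex S × AugVertex S)) :
    Finset (Fin n) :=
  Finset.univ.filter fun i => ∃ y : {i // i ∈ S}, (Sum.inl i, Sum.inr y) ∈ H

/-- `C` is a possible output of the matching based algorithm with data `A, F`, for some choice of
the maximum weight maximum matching `H`, of the order `e` of the set `X_H` of the states that `H`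
joins to outputs, and of the row `c j` used for each functional state `x_j` outside `X_H` from
which no element of `X_H` can be reached. -/
def MatchingReturns {n p r : ℕ} (A : StructMat (Fin n) (Fin n)) (F : StructMat (Fin r) (Fin n))
    (C : StructMat (Fin p) (Fin n)) : Prop :=
  ∃ H : Finset (AugVertex (nonzeroCols F) × AugVertex (nonzeroCols F)),
    IsMaxWeightMaximumMatching (augEdge A (nonzeroCols F)) (augCost A (nonzeroCols F)) H ∧
    p = max 1 (matchedToOutput H).card ∧
    ∃ (e : Fin (matchedToOutput H).card ≃ {i // i ∈ matchedToOutput H}) (c : Fin n → Fin p),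
      ∀ (k : Fin p) (j : Fin n), C k j = true ↔
        (∃ l : Fin (matchedToOutput H).card, (l : ℕ) = (k : ℕ) ∧ (e l : Fin n) = j) ∨
        (j ∈ nonzeroCols F ∧ j ∉ matchedToOutput H ∧
          (∀ i ∈ matchedToOutput H, ¬ StateReach A j i) ∧ c j = k)

/-- `C` is feasible for the sensor placement problem, has its nonzero columns among the functional
states, and has the fewest rows among all such matrices. -/
def IsConstrainedOptimal {n p r : ℕ} (A : StructMat (Fin n) (Fin n))
    (F : StructMat (Fin r) (Fin n)) (C : StructMat (Fin p) (Fin n)) : Prop :=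
  IsSFO A C F ∧ nonzeroCols C ⊆ nonzeroCols F ∧
    ∀ (p' : ℕ) (C' : StructMat (Fin p') (Fin n)),
      IsSFO A C' F → nonzeroCols C' ⊆ nonzeroCols F → p ≤ p'

/-- `C` is feasible for the sensor placement problem and has the fewest rows among all feasible
matrices. -/
def IsOptimal {n p r : ℕ} (A : StructMat (Fin n) (Fin n))
    (F : StructMat (Fin r) (Fin n)) (C : StructMat (Fin p) (Fin n)) : Prop :=
  IsSFO A C F ∧ ∀ (p' : ℕ) (C' : StructMat (Fin p') (Fin n)), IsSFO A C' F → p ≤ p'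

end StructSys

end

open scoped Matrix

noncomputable section

namespace StructSys

/-! Functional observability says that `F` vanishes on the unobservable subspace `U` of `(A, C)`
(`functionallyObservable_iff`); structurally, the coordinates in `X_F` vanish generically on `U`
(`isSFO_iff_generic`). If `C` has its nonzero columns in `X_F`, then `U` always contains the
subspace left unobservable by reading every functional state separately. Feasibility is then
equality of the two subspaces, which is a comparison of generic ranks (`isSFO_iff_grankObs`).

For Algorithm 2, the loop guard is exactly infeasibility (`loopGuard_iff`), and `k` copies of `η`
form the pattern with the most free entries among the `k`-row patterns supported on `X_F`. The loop
therefore stops at the least feasible number of rows.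

Algorithm 3 rests on a combinatorial formula: the generic rank of the observability matrix is the
largest number of states covered by a linking, an injective map from states to states and outputs
that moves along edges ending in an output or in a state that reaches one. Upper bound
(`exists_obsEdge_linking_rank_le`): an output injection `G` can be chosen such that all zero modes
of `A + G C` lie in `U` (`exists_gain`). Then some Leibniz term of `det [[X - A, G], [C, 1]]` is not
divisible by `X ^ (dim U + 1)`. This term is a linking, and each state it leaves uncovered costs a
factor `X`. Lower bound (`linkSize_le_grankObs`): two generic rank conditions are combined. A
realization made of disjoint cycles with distinct weights, joined by a forest of exits towards the
outputs, has no unobservable nonzero mode (`eq_zero_of_unobservable_mode`); hence `A` is generically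
nilpotent on `U`. A linking closed up by a constant injection `G` makes the rank of `(A + G C) ^ n`
at least its size. As `A + G C` agrees with `A` on `U`, the kernel of that power contains `U`, which
bounds `dim U`.

A maximum matching of the augmented graph is a permutation, hence yields a linking, with weight `(q
+ 1) * size - outputs used`. At most `q` outputs are used, so the maximum weight selects the largest
size and then the fewest outputs.

Optimality among all matrices: if `A` is diagonalizable and `p'` sensors suffice, the eigenspaces
have images of dimension at most `p'` in the functional coordinates, so `p'` general combinations of
functional states suffice too. For `F = I` the support constraint is vacuous. -/

/-! Ranks and minors -/

/-- A matrix over a field has a nonvanishing minor of each size up to its rank. -/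
theorem exists_minor_of_le_rank {K m n : Type} [Field K] [Fintype m] [Fintype n]
    (M : Matrix m n K) {k : ℕ} (h : k ≤ M.rank) :
    ∃ (r : Fin k → m) (c : Fin k → n), (M.submatrix r c).det ≠ 0 := by
  have key : ∀ {a b : Type} [Fintype a] [Fintype b] (N : Matrix a b K), k ≤ N.rank →
      ∃ r : Fin k → a, LinearIndependent K fun i => N.row (r i) := by
    intro a b _ _ N hN
    obtain ⟨κ, f, hf, hs, hl⟩ := exists_linearIndependent' K N.row
    have : Finite κ := Finite.of_injective f hf
    have := Fintype.ofFinite κ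
    rw [Matrix.rank_eq_finrank_span_row, ← hs, finrank_span_eq_card hl] at hN
    obtain ⟨g⟩ : Nonempty (Fin k ↪ κ) := Function.Embedding.nonempty_of_card_le (by simpa using hN)
    exact ⟨fun i => f (g i), hl.comp g g.injective⟩
  obtain ⟨r, hr⟩ := key M h
  have h1 : (M.submatrix r id).rank = k := by
    have := LinearIndependent.rank_matrix (M := M.submatrix r id) hr
    simpa using this
  obtain ⟨c, hc⟩ := key (M.submatrix r id)ᵀ (by rw [Matrix.rank_transpose, h1])
  refine ⟨r, c, ?_⟩
  have h2 : LinearIndependent K ((M.submatrix r c)ᵀ).row := hc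
  rw [Matrix.linearIndependent_rows_iff_isUnit, Matrix.isUnit_iff_isUnit_det,
    Matrix.det_transpose] at h2
  exact h2.ne_zero

theorem le_rank_of_minor_ne_zero {K m n : Type} [Field K] [Fintype m] [Fintype n]
    (M : Matrix m n K) {k : ℕ} (r : Fin k → m) (c : Fin k → n)
    (h : (M.submatrix r c).det ≠ 0) : k ≤ M.rank := by
  have h1 := Matrix.rank_of_det_ne_zero h
  rw [Fintype.card_fin] at h1
  calc k = (M.submatrix r c).rank := h1.symm
    _ ≤ M.rank := Matrix.rank_submatrix_le _ _ _

theorem le_rank_map {K L m n : Type} [Field K] [Field L] [Fintype m] [Fintype n] (f : K →+* L)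
    (M : Matrix m n K) {k : ℕ} (h : k ≤ M.rank) : k ≤ (M.map f).rank := by
  obtain ⟨r, c, hd⟩ := exists_minor_of_le_rank M h
  refine le_rank_of_minor_ne_zero _ r c ?_
  rw [Matrix.submatrix_map, ← RingHom.mapMatrix_apply, ← RingHom.map_det]
  simpa using hd

/-! Generic properties of real parameters -/

/-- A property holds generically if it holds where some nonzero polynomial does not vanish. -/
def Generic {σ : Type} (P : (σ → ℝ) → Prop) : Prop :=
  ∃ g : MvPolynomial σ ℝ, g ≠ 0 ∧ ∀ θ, MvPolynomial.eval θ g ≠ 0 → P θ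

theorem exists_eval_ne_zero {σ : Type} {g : MvPolynomial σ ℝ} (hg : g ≠ 0) :
    ∃ θ, MvPolynomial.eval θ g ≠ 0 := by
  by_contra! h
  exact hg (MvPolynomial.funext fun θ => by simpa using h θ)

theorem Generic.exists {σ : Type} {P : (σ → ℝ) → Prop} (h : Generic P) : ∃ θ, P θ := by
  obtain ⟨g, hg, hP⟩ := h
  obtain ⟨θ, hθ⟩ := exists_eval_ne_zero hg
  exact ⟨θ, hP θ hθ⟩

theorem Generic.mono {σ : Type} {P Q : (σ → ℝ) → Prop} (h : Generic P) (hPQ : ∀ θ, P θ → Q θ) :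
    Generic Q := by
  obtain ⟨g, hg, hP⟩ := h
  exact ⟨g, hg, fun θ hθ => hPQ θ (hP θ hθ)⟩

theorem Generic.and {σ : Type} {P Q : (σ → ℝ) → Prop} (hP : Generic P) (hQ : Generic Q) :
    Generic fun θ => P θ ∧ Q θ := by
  obtain ⟨g, hg, hP⟩ := hP
  obtain ⟨g', hg', hQ⟩ := hQ
  refine ⟨g * g', mul_ne_zero hg hg', fun θ hθ => ?_⟩
  rw [map_mul] at hθ
  exact ⟨hP θ (left_ne_zero_of_mul hθ), hQ θ (right_ne_zero_of_mul hθ)⟩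

theorem Generic.comp {σ τ : Type} {P : (σ → ℝ) → Prop} (h : Generic P) (f : σ → τ)
    (hf : Function.Injective f) : Generic fun θ : τ → ℝ => P (θ ∘ f) := by
  obtain ⟨g, hg, hP⟩ := h
  refine ⟨MvPolynomial.rename f g, ?_, fun θ hθ => hP _ ?_⟩
  · rwa [Ne, map_eq_zero_iff _ (MvPolynomial.rename_injective f hf)]
  · rwa [MvPolynomial.eval_rename] at hθ

/-- A point off the variety is detected by one polynomial of the ideal, which is then nonzero and
cuts out a hypersurface containing the variety. Conversely, a real hypersurface `g = 0` with `g ≠ 0`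
is proper, as `ℝ` is infinite. -/
theorem generic_iff_properVariety {σ : Type} (P : (σ → ℝ) → Prop) :
    (∃ V : Set (σ → ℝ), IsProperVariety V ∧ ∀ θ, θ ∉ V → P θ) ↔ Generic P := by
  constructor
  · rintro ⟨V, ⟨⟨I, rfl⟩, hV⟩, hP⟩
    obtain ⟨θ, hθ⟩ := (Set.ne_univ_iff_exists_notMem _).1 hV
    have h : ∃ g ∈ I, MvPolynomial.eval θ g ≠ 0 := by
      by_contra! h
      exact hθ fun p hp => by simpa [MvPolynomial.aeval_eq_eval] using h p hp
    obtain ⟨g, hg, hgθ⟩ := h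
    refine ⟨g, fun h0 => hgθ (by simp [h0]), fun θ' h' => hP θ' fun hmem => h' ?_⟩
    simpa [MvPolynomial.aeval_eq_eval] using hmem g hg
  · rintro ⟨g, hg, hP⟩
    refine ⟨MvPolynomial.zeroLocus ℝ (Ideal.span {g}), ⟨⟨_, rfl⟩, ?_⟩, fun θ hθ => hP θ ?_⟩
    · obtain ⟨θ, hθ⟩ := exists_eval_ne_zero hg
      refine (Set.ne_univ_iff_exists_notMem _).2 ⟨θ, fun hmem => hθ ?_⟩
      simpa [MvPolynomial.aeval_eq_eval] using hmem g (Ideal.subset_span rfl)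
    · intro h0
      refine hθ ?_
      rw [MvPolynomial.zeroLocus_span]
      intro p hp
      rw [Set.mem_singleton_iff.1 hp]
      simpa [MvPolynomial.aeval_eq_eval] using h0

/-- The rank of a polynomial matrix is generically at least its rank at any point, which may
have coordinates in an extension field. -/
theorem generic_le_rank {σ m n K : Type} [Field K] [Algebra ℝ K] [Fintype m] [Fintype n]
    (M : Matrix m n (MvPolynomial σ ℝ)) {k : ℕ} (θ₀ : σ → K)
    (h : k ≤ (M.map (MvPolynomial.aeval θ₀)).rank) :
    Generic fun θ : σ → ℝ => k ≤ (M.map (MvPolynomial.aeval θ)).rank := by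
  obtain ⟨r, c, hd⟩ := exists_minor_of_le_rank _ h
  -- One polynomial with real coefficients computes the minor over every extension field, so a
  -- nonzero value at a complex point already shows that it is nonzero, hence generically nonzero at
  -- real points.
  have hdet : ∀ {L : Type} [Field L] [Algebra ℝ L] (θ : σ → L),
      ((M.map (MvPolynomial.aeval θ)).submatrix r c).det =
        MvPolynomial.aeval θ (M.submatrix r c).det := by
    intro L _ _ θ
    rw [Matrix.submatrix_map, AlgHom.map_det]
    rfl
  refine ⟨(M.submatrix r c).det, fun h0 => hd ?_, fun θ hθ => ?_⟩
  · rw [hdet, h0, map_zero]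
  · refine le_rank_of_minor_ne_zero _ r c ?_
    rw [hdet]
    simpa [MvPolynomial.aeval_eq_eval] using hθ

/-! The observability matrix and the unobservable subspace -/

/-- The unobservable subspace of `(A, C)`. -/
def unobs {K m : Type} [Field K] {n : ℕ} (A : Matrix (Fin n) (Fin n) K) (C : Matrix m (Fin n) K) :
    Submodule K (Fin n → K) where
  carrier := {v | ∀ k : ℕ, C *ᵥ (A ^ k *ᵥ v) = 0}
  add_mem' := fun {v w} hv hw k => by simp [Matrix.mulVec_add, hv k, hw k]
  zero_mem' := fun k => by simp
  smul_mem' := fun c v hv k => by simp [Matrix.mulVec_smul, hv k]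

section unobs
variable {K m : Type} [Field K] {n : ℕ} {A : Matrix (Fin n) (Fin n) K} {C : Matrix m (Fin n) K}

theorem mem_unobs {v : Fin n → K} : v ∈ unobs A C ↔ ∀ k : ℕ, C *ᵥ (A ^ k *ᵥ v) = 0 := Iff.rfl

theorem mulVec_eq_zero_of_mem_unobs {v : Fin n → K} (hv : v ∈ unobs A C) : C *ᵥ v = 0 := by
  simpa using hv 0

theorem mulVec_mem_unobs {v : Fin n → K} (hv : v ∈ unobs A C) : A *ᵥ v ∈ unobs A C := fun k => by
  have := hv (k + 1)
  rwa [pow_succ, ← Matrix.mulVec_mulVec] at this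

theorem pow_mulVec_mem_unobs {v : Fin n → K} (hv : v ∈ unobs A C) (k : ℕ) :
    A ^ k *ᵥ v ∈ unobs A C := by
  induction k with
  | zero => simpa using hv
  | succ k ih =>
    rw [pow_succ', ← Matrix.mulVec_mulVec]
    exact mulVec_mem_unobs ih

/-- Cayley–Hamilton: `A ^ k` is a polynomial of degree less than `n` in `A`. -/
theorem mem_unobs_of_forall_lt {v : Fin n → K} (hv : ∀ k < n, C *ᵥ (A ^ k *ᵥ v) = 0) :
    v ∈ unobs A C := by
  intro k
  rw [Matrix.pow_eq_aeval_mod_charpoly]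
  have hdeg : (Polynomial.X ^ k %ₘ A.charpoly).degree < n := by
    have h := Polynomial.degree_modByMonic_lt (Polynomial.X ^ k) A.charpoly_monic
    rwa [Matrix.charpoly_degree_eq_dim, Fintype.card_fin] at h
  generalize Polynomial.X ^ k %ₘ A.charpoly = p at hdeg
  rw [Polynomial.aeval_def, Polynomial.eval₂_eq_sum, Polynomial.sum_def, Matrix.sum_mulVec,
    Matrix.mulVec_sum]
  refine Finset.sum_eq_zero fun i hi => ?_
  have hi' : i < n := by
    have h1 := Polynomial.le_degree_of_mem_supp i hi
    exact_mod_cast lt_of_le_of_lt h1 hdeg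
  rw [← Algebra.smul_def, Matrix.smul_mulVec, Matrix.mulVec_smul, hv i hi', smul_zero]

end unobs

/-- The observability matrix over a commutative ring. -/
def obsMat {R m : Type} [CommRing R] {n : ℕ} (A : Matrix (Fin n) (Fin n) R)
    (C : Matrix m (Fin n) R) : Matrix (Fin n × m) (Fin n) R :=
  fun ki j => (C * A ^ (ki.1 : ℕ)) ki.2 j

theorem obsMat_map {R S m : Type} [CommRing R] [CommRing S] {n : ℕ} (f : R →+* S)
    (A : Matrix (Fin n) (Fin n) R) (C : Matrix m (Fin n) R) :
    (obsMat A C).map f = obsMat (A.map f) (C.map f) := by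
  ext ⟨k, y⟩ j
  change f ((C * A ^ (k : ℕ)) y j) = (C.map f * (A.map f) ^ (k : ℕ)) y j
  rw [← Matrix.map_apply (M := C * A ^ (k : ℕ)) (f := f), Matrix.map_mul, Matrix.map_pow]

theorem ker_obsMat {K m : Type} [Field K] [Fintype m] {n : ℕ} (A : Matrix (Fin n) (Fin n) K)
    (C : Matrix m (Fin n) K) : LinearMap.ker (obsMat A C).mulVecLin = unobs A C := by
  ext v
  have h : ∀ (k : Fin n) (y : m), (obsMat A C *ᵥ v) (k, y) = (C *ᵥ (A ^ (k : ℕ) *ᵥ v)) y := by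
    intro k y
    rw [Matrix.mulVec_mulVec]
    rfl
  rw [LinearMap.mem_ker, Matrix.mulVecLin_apply]
  constructor
  · intro h0
    refine mem_unobs_of_forall_lt fun k hk => funext fun y => ?_
    have := congrFun h0 (⟨k, hk⟩, y)
    rwa [h] at this
  · intro h0
    funext ⟨k, y⟩
    rw [h, h0 k]
    rfl

theorem rank_obsMat {K m : Type} [Field K] [Fintype m] {n : ℕ} (A : Matrix (Fin n) (Fin n) K)
    (C : Matrix m (Fin n) K) :
    (obsMat A C).rank + Module.finrank K (unobs A C) = n := by
  have h := LinearMap.finrank_range_add_finrank_ker (obsMat A C).mulVecLin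
  rw [ker_obsMat] at h
  simpa [Matrix.rank] using h

theorem rank_obsMat_le {K m : Type} [Field K] [Fintype m] {n : ℕ} (A : Matrix (Fin n) (Fin n) K)
    (C : Matrix m (Fin n) K) : (obsMat A C).rank ≤ n := by
  have := rank_obsMat A C
  omega

theorem rank_obsMat_le_of_unobs_le {K m m' : Type} [Field K] [Fintype m] [Fintype m'] {n : ℕ}
    {A : Matrix (Fin n) (Fin n) K} {C : Matrix m (Fin n) K} {C' : Matrix m' (Fin n) K}
    (h : unobs A C' ≤ unobs A C) : (obsMat A C).rank ≤ (obsMat A C').rank := by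
  have h1 := rank_obsMat A C
  have h2 := rank_obsMat A C'
  have h3 := Submodule.finrank_mono h
  omega

theorem unobs_eq_of_rank_le {K m m' : Type} [Field K] [Fintype m] [Fintype m'] {n : ℕ}
    {A : Matrix (Fin n) (Fin n) K} {C : Matrix m (Fin n) K} {C' : Matrix m' (Fin n) K}
    (h : unobs A C' ≤ unobs A C) (hr : (obsMat A C').rank ≤ (obsMat A C).rank) :
    unobs A C' = unobs A C := by
  have h1 := rank_obsMat A C
  have h2 := rank_obsMat A C'
  refine Submodule.eq_of_le_of_finrank_le h (by omega)

/-! Functional observability through the unobservable subspace -/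

section FO
variable {n p r : ℕ} {A : Matrix (Fin n) (Fin n) ℝ} {C : Matrix (Fin p) (Fin n) ℝ}
  {F : Matrix (Fin r) (Fin n) ℝ}

theorem hasDerivAt_of_eq_integral {z : ℝ → Fin n → ℝ} (hc : ContinuousOn z (Set.Ici 0))
    (hz : ∀ t, 0 ≤ t → z t = z 0 + ∫ s in (0 : ℝ)..t, A *ᵥ z s) {t : ℝ} (ht : 0 < t) :
    HasDerivAt z (A *ᵥ z t) t := by
  -- `z` is continuous only on `[0, ∞)`; composing with `max s 0` gives an integrand continuous on
  -- the whole line, to which the fundamental theorem of calculus applies.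
  have hg : Continuous fun s => A *ᵥ z (max s 0) := by
    have h1 : Continuous fun s : ℝ => z (max s 0) :=
      hc.comp_continuous (by fun_prop) fun s => Set.mem_Ici.2 (le_max_right _ _)
    exact Continuous.matrix_mulVec continuous_const h1
  have hd := (intervalIntegral.integral_hasDerivAt_right (hg.intervalIntegrable 0 t)
    hg.stronglyMeasurable.stronglyMeasurableAtFilter hg.continuousAt).const_add (z 0)
  rw [max_eq_left ht.le] at hd
  refine hd.congr_of_eventuallyEq ?_
  filter_upwards [lt_mem_nhds ht] with s hs
  rw [hz s hs.le]
  congr 1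
  refine intervalIntegral.integral_congr fun u hu => ?_
  rw [Set.uIcc_of_le hs.le] at hu
  simp only [max_eq_left hu.1]

/-- An output that vanishes on an interval `[0, T]` along a solution of `z' = A z` has vanishing
derivatives, so that the initial state is unobservable. -/
theorem mem_unobs_of_output_eq_zero {T : ℝ} (hT : 0 < T) {z : ℝ → Fin n → ℝ}
    (hc : ContinuousOn z (Set.Ici 0))
    (hz : ∀ t, 0 ≤ t → z t = z 0 + ∫ s in (0 : ℝ)..t, A *ᵥ z s)
    (h0 : ∀ t ∈ Set.Icc 0 T, C *ᵥ z t = 0) : z 0 ∈ unobs A C := by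
  have h : ∀ k : ℕ, ∀ t ∈ Set.Ioo 0 T, (C * A ^ k) *ᵥ z t = 0 := by
    intro k
    induction k with
    | zero => simpa using fun t h1 h2 => h0 t ⟨h1.le, h2.le⟩
    | succ k ih =>
      intro t ht
      have hd := hasDerivAt_of_eq_integral hc hz ht.1
      have h1 : HasDerivAt (fun s => (C * A ^ k) *ᵥ z s) ((C * A ^ k) *ᵥ (A *ᵥ z t)) t :=
        ((C * A ^ k).mulVecLin.toContinuousLinearMap.hasFDerivAt (x := z t)).comp_hasDerivAt t hd
      have h2 : HasDerivAt (fun s => (C * A ^ k) *ᵥ z s) 0 t := by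
        refine (hasDerivAt_const t (0 : Fin p → ℝ)).congr_of_eventuallyEq ?_
        filter_upwards [Ioo_mem_nhds ht.1 ht.2] with s hs
        exact ih s hs
      have h3 := h1.unique h2
      rwa [Matrix.mulVec_mulVec, Matrix.mul_assoc, ← pow_succ] at h3
  intro k
  rw [Matrix.mulVec_mulVec]
  have hcont : ContinuousOn (fun t => (C * A ^ k) *ᵥ z t) (Set.Icc 0 T) := by
    have h1 : Continuous fun v : Fin n → ℝ => (C * A ^ k) *ᵥ v := by fun_prop
    exact h1.comp_continuousOn (hc.mono fun t ht => ht.1)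
  have h1 : Set.EqOn (fun t => (C * A ^ k) *ᵥ z t) 0 (Set.Icc 0 T) := by
    refine Set.EqOn.of_subset_closure (s := Set.Ioo 0 T) (fun t ht => h k t ht) hcont
      continuousOn_const Set.Ioo_subset_Icc_self ?_
    rw [closure_Ioo hT.ne]
  exact h1 ⟨le_rfl, hT.le⟩

section
attribute [local instance] Matrix.linftyOpNormedRing Matrix.linftyOpNormedAlgebra

theorem mulVec_exp_eq_zero {v : Fin n → ℝ} (hv : v ∈ unobs A C) (t : ℝ) :
    C *ᵥ (NormedSpace.exp (t • A) *ᵥ v) = 0 := by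
  have h := NormedSpace.exp_series_hasSum_exp' (𝕂 := ℝ) (t • A)
  let L : Matrix (Fin n) (Fin n) ℝ →ₗ[ℝ] Fin p → ℝ :=
    { toFun := fun M => C *ᵥ (M *ᵥ v)
      map_add' := fun M N => by simp [Matrix.add_mulVec, Matrix.mulVec_add]
      map_smul' := fun c M => by simp [Matrix.smul_mulVec, Matrix.mulVec_smul] }
  have h1 := h.map L.toAddMonoidHom L.toContinuousLinearMap.continuous
  refine h1.unique ?_
  have h2 : ∀ k : ℕ, L ((k.factorial⁻¹ : ℝ) • (t • A) ^ k) = 0 := by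
    intro k
    rw [map_smul, smul_pow, map_smul]
    change _ • _ • (C *ᵥ (A ^ k *ᵥ v)) = 0
    rw [hv k, smul_zero, smul_zero]
  convert! hasSum_zero using 1
  funext k
  exact h2 k

theorem isTrajectory_exp (A : Matrix (Fin n) (Fin n) ℝ) (v : Fin n → ℝ) :
    IsTrajectory A (0 : Matrix (Fin n) (Fin 0) ℝ) 0
      (fun t => NormedSpace.exp (t • A) *ᵥ v) := by
  let L : Matrix (Fin n) (Fin n) ℝ →ₗ[ℝ] Fin n → ℝ :=
    { toFun := fun M => M *ᵥ v
      map_add' := fun M N => by simp [Matrix.add_mulVec]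
      map_smul' := fun c M => by simp [Matrix.smul_mulVec] }
  have hd : ∀ t : ℝ, HasDerivAt (fun t : ℝ => NormedSpace.exp (t • A) *ᵥ v)
      (A *ᵥ (NormedSpace.exp (t • A) *ᵥ v)) t := by
    intro t
    have h1 := hasDerivAt_exp_smul_const' (𝕂 := ℝ) A t
    have h2 := (L.toContinuousLinearMap.hasFDerivAt (x := NormedSpace.exp (t • A))).comp_hasDerivAt
      t h1
    rw [Matrix.mulVec_mulVec]
    exact h2
  have hc : Continuous fun t : ℝ => NormedSpace.exp (t • A) *ᵥ v :=
    continuous_iff_continuousAt.2 fun t => (hd t).continuousAt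
  refine ⟨hc.continuousOn, fun t _ => ?_⟩
  have hi := intervalIntegral.integral_eq_sub_of_hasDerivAt (a := 0) (b := t)
    (fun s _ => hd s) (Continuous.intervalIntegrable (by fun_prop) _ _)
  simp only [Matrix.zero_mulVec, add_zero]
  rw [hi]
  abel

end

/-- For necessity, the trajectory `exp (t A) v` with `v` unobservable has the same zero output as
the zero trajectory. For sufficiency, the difference of two trajectories with the same input solves
`z' = A z`, and its vanishing output on `[0, 1]` makes `z 0` unobservable. -/
theorem functionallyObservable_iff :
    FunctionallyObservable A C F ↔ ∀ v ∈ unobs A C, F *ᵥ v = 0 := by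
  constructor
  · intro h v hv
    have h0 : IsTrajectory A (0 : Matrix (Fin n) (Fin 0) ℝ) 0 (fun _ => 0) :=
      ⟨continuousOn_const, fun t _ => by simp⟩
    obtain ⟨T, -, hT⟩ := h 0 0 0 (fun t _ => intervalIntegrable_const) _ h0
    have := hT _ (isTrajectory_exp A v) fun t _ => by
      rw [mulVec_exp_eq_zero hv, Matrix.mulVec_zero]
    simpa using this
  · intro h m B u hu x hx
    refine ⟨1, one_pos, fun x' hx' hy => ?_⟩
    have hint : ∀ {x : ℝ → Fin n → ℝ}, IsTrajectory A B u x → ∀ t : ℝ, 0 ≤ t →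
        IntervalIntegrable (fun s => A *ᵥ x s) MeasureTheory.volume 0 t := by
      intro x hx t ht
      refine ContinuousOn.intervalIntegrable ?_
      have h1 : Continuous fun v : Fin n → ℝ => A *ᵥ v := by fun_prop
      refine h1.comp_continuousOn (hx.continuousOn.mono ?_)
      rw [Set.uIcc_of_le ht]
      exact fun s hs => hs.1
    have hB : ∀ t : ℝ, 0 ≤ t →
        IntervalIntegrable (fun s => B *ᵥ u s) MeasureTheory.volume 0 t := by
      intro t ht
      have h1 := hu t ht
      exact ⟨B.mulVecLin.toContinuousLinearMap.integrable_comp h1.1,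
        B.mulVecLin.toContinuousLinearMap.integrable_comp h1.2⟩
    have hmem : (fun t => x' t - x t) 0 ∈ unobs A C := by
      refine mem_unobs_of_output_eq_zero one_pos (hx'.continuousOn.sub hx.continuousOn)
        (fun t ht => ?_) fun t ht => ?_
      · have e1 := hx'.eq_integral t ht
        have e2 := hx.eq_integral t ht
        rw [intervalIntegral.integral_add (hint hx' t ht) (hB t ht)] at e1
        rw [intervalIntegral.integral_add (hint hx t ht) (hB t ht)] at e2
        simp only [Pi.sub_apply, Matrix.mulVec_sub]
        rw [intervalIntegral.integral_sub (hint hx' t ht) (hint hx t ht), e1, e2]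
        abel
      · rw [Pi.sub_apply, Matrix.mulVec_sub, hy t ht, sub_self]
    have := h _ hmem
    rw [Matrix.mulVec_sub] at this
    exact sub_eq_zero.1 this

end FO

/-! Realizations of structured matrices -/

/-- The numerical matrix `N` has the zero pattern of `M`. -/
def Fits {m n K : Type} [Zero K] (M : StructMat m n) (N : Matrix m n K) : Prop :=
  ∀ i j, N i j ≠ 0 → M i j = true

theorem fits_realize {m n : Type} (M : StructMat m n) (θ : Param M → ℝ) : Fits M (realize M θ) := by
  intro i j h
  by_contra h'
  exact h (dif_neg h')

theorem Fits.eq_realize {m n : Type} {M : StructMat m n} {N : Matrix m n ℝ} (h : Fits M N) :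
    realize M (fun e => N e.1.1 e.1.2) = N := by
  ext i j
  unfold realize
  split_ifs with h'
  · rfl
  · by_contra h0
    exact h' (h i j (Ne.symm h0))

/-- The realization of `M` whose free entries are variables. -/
def polyRealize {m n σ : Type} (M : StructMat m n) (f : Param M → σ) :
    Matrix m n (MvPolynomial σ ℝ) :=
  fun i j => if h : M i j = true then MvPolynomial.X (f ⟨(i, j), h⟩) else 0

theorem polyRealize_map {m n σ : Type} (M : StructMat m n) (f : Param M → σ) (θ : σ → ℝ) :
    (polyRealize M f).map (MvPolynomial.aeval θ) = realize M fun e => θ (f e) := by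
  ext i j
  simp only [Matrix.map_apply, polyRealize, realize]
  split_ifs <;> simp

theorem Fits.polyRealize_map {m n σ K : Type} [Field K] [Algebra ℝ K] {M : StructMat m n}
    {N : Matrix m n K} (h : Fits M N) (f : Param M → σ) (θ : σ → K)
    (hθ : ∀ e, θ (f e) = N e.1.1 e.1.2) : (polyRealize M f).map (MvPolynomial.aeval θ) = N := by
  ext i j
  simp only [Matrix.map_apply, polyRealize]
  split_ifs with h'
  · simpa using hθ ⟨(i, j), h'⟩
  · rw [map_zero]
    by_contra h0
    exact h' (h i j (Ne.symm h0))

/-- A property of pairs of matrices holds for generic realizations of `(A, C)`. -/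
def GenericPair {a b c d : Type} (A : StructMat a b) (C : StructMat c d)
    (P : Matrix a b ℝ → Matrix c d ℝ → Prop) : Prop :=
  Generic fun θ : Param A ⊕ Param C → ℝ =>
    P (realize A fun e => θ (Sum.inl e)) (realize C fun e => θ (Sum.inr e))

theorem GenericPair.and {a b c d : Type} {A : StructMat a b} {C : StructMat c d}
    {P Q : Matrix a b ℝ → Matrix c d ℝ → Prop} (h : GenericPair A C P) (h' : GenericPair A C Q) :
    GenericPair A C fun M N => P M N ∧ Q M N := Generic.and h h'

theorem GenericPair.mono {a b c d : Type} {A : StructMat a b} {C : StructMat c d}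
    {P Q : Matrix a b ℝ → Matrix c d ℝ → Prop} (h : GenericPair A C P)
    (h' : ∀ M N, Fits A M → Fits C N → P M N → Q M N) : GenericPair A C Q :=
  Generic.mono h fun _ => h' _ _ (fits_realize _ _) (fits_realize _ _)

theorem GenericPair.exists {a b c d : Type} {A : StructMat a b} {C : StructMat c d}
    {P : Matrix a b ℝ → Matrix c d ℝ → Prop} (h : GenericPair A C P) :
    ∃ M N, Fits A M ∧ Fits C N ∧ P M N := by
  obtain ⟨θ, hθ⟩ := Generic.exists h
  exact ⟨_, _, fits_realize _ _, fits_realize _ _, hθ⟩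

/-- Lower bounds of the rank of a matrix that depends polynomially on a realization are generic
properties. -/
theorem genericPair_le_rank {a b c d u v K : Type} [Field K] [Algebra ℝ K] [Fintype u] [Fintype v]
    {A : StructMat a b} {C : StructMat c d}
    (Φ : ∀ {R : Type} [CommRing R] [Algebra ℝ R], Matrix a b R → Matrix c d R → Matrix u v R)
    (hΦ : ∀ {R R' : Type} [CommRing R] [Algebra ℝ R] [CommRing R'] [Algebra ℝ R'] (f : R →ₐ[ℝ] R')
      (M : Matrix a b R) (N : Matrix c d R), (Φ M N).map f = Φ (M.map f) (N.map f))
    {M₀ : Matrix a b K} {N₀ : Matrix c d K} (hM : Fits A M₀) (hN : Fits C N₀) {k : ℕ}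
    (hk : k ≤ (Φ M₀ N₀).rank) : GenericPair A C fun M N => k ≤ (Φ M N).rank := by
  have h := generic_le_rank (k := k) (Φ (polyRealize A Sum.inl) (polyRealize C Sum.inr))
    (Sum.elim (fun e : Param A => M₀ e.1.1 e.1.2) fun e : Param C => N₀ e.1.1 e.1.2)
    (by rwa [hΦ, hM.polyRealize_map _ _ (fun _ => rfl), hN.polyRealize_map _ _ (fun _ => rfl)])
  refine Generic.mono h fun θ hθ => ?_
  rwa [hΦ, polyRealize_map, polyRealize_map] at hθ

theorem genericPair_le_rank_obsMat {m K : Type} [Field K] [Algebra ℝ K] [Fintype m] {n : ℕ}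
    {A : StructMat (Fin n) (Fin n)} {C : StructMat m (Fin n)}
    {M₀ : Matrix (Fin n) (Fin n) K} {N₀ : Matrix m (Fin n) K} (hM : Fits A M₀) (hN : Fits C N₀)
    {k : ℕ} (hk : k ≤ (obsMat M₀ N₀).rank) :
    GenericPair A C fun M N => k ≤ (obsMat M N).rank :=
  genericPair_le_rank (fun M N => obsMat M N) (fun f M N => obsMat_map f.toRingHom M N) hM hN hk

/-! The generic rank of the observability matrix -/

section grank
variable {m : Type} [Fintype m] {n : ℕ} {A : StructMat (Fin n) (Fin n)} {C : StructMat m (Fin n)}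

theorem bddAbove_rank_obs (A : StructMat (Fin n) (Fin n)) (C : StructMat m (Fin n)) :
    BddAbove (Set.range fun θ : Param A ⊕ Param C → ℝ =>
      (obsMatrix (realize A fun a => θ (Sum.inl a)) (realize C fun c => θ (Sum.inr c))).rank) := by
  refine ⟨n, ?_⟩
  rintro _ ⟨θ, rfl⟩
  exact rank_obsMat_le _ _

theorem rank_le_grankObs {M : Matrix (Fin n) (Fin n) ℝ} {N : Matrix m (Fin n) ℝ} (hM : Fits A M)
    (hN : Fits C N) : (obsMat M N).rank ≤ grankObs A C := by
  have h := le_ciSup (bddAbove_rank_obs A C)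
    (Sum.elim (fun e : Param A => M e.1.1 e.1.2) fun e : Param C => N e.1.1 e.1.2)
  simp only [Sum.elim_inl, Sum.elim_inr, hM.eq_realize, hN.eq_realize] at h
  exact h

theorem exists_rank_eq_grankObs (A : StructMat (Fin n) (Fin n)) (C : StructMat m (Fin n)) :
    ∃ (M : Matrix (Fin n) (Fin n) ℝ) (N : Matrix m (Fin n) ℝ),
      Fits A M ∧ Fits C N ∧ (obsMat M N).rank = grankObs A C := by
  obtain ⟨θ, hθ⟩ := Nat.sSup_mem (Set.range_nonempty _) (bddAbove_rank_obs A C)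
  exact ⟨_, _, fits_realize _ _, fits_realize _ _, hθ⟩

theorem genericPair_rank_eq_grankObs (A : StructMat (Fin n) (Fin n)) (C : StructMat m (Fin n)) :
    GenericPair A C fun M N => (obsMat M N).rank = grankObs A C := by
  obtain ⟨M, N, hM, hN, h⟩ := exists_rank_eq_grankObs A C
  exact (genericPair_le_rank_obsMat hM hN h.ge).mono fun M' N' hM' hN' h' =>
    le_antisymm (rank_le_grankObs hM' hN') h'

theorem le_grankObs {K : Type} [Field K] [Algebra ℝ K] {M : Matrix (Fin n) (Fin n) K}
    {N : Matrix m (Fin n) K} (hM : Fits A M) (hN : Fits C N) {k : ℕ}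
    (hk : k ≤ (obsMat M N).rank) : k ≤ grankObs A C := by
  obtain ⟨M', N', hM', hN', h⟩ := (genericPair_le_rank_obsMat hM hN hk).exists
  exact h.trans (rank_le_grankObs hM' hN')

end grank

/-! Direct observation of states -/

/-- The output matrix that reads the states in `S`. -/
def stateSel (K : Type) [Zero K] [One K] {n : ℕ} (S : Finset (Fin n)) :
    Matrix {i // i ∈ S} (Fin n) K :=
  fun i j => if i.1 = j then 1 else 0

section stateSel
variable {K m : Type} [Field K] {n : ℕ} {S : Finset (Fin n)} {A : Matrix (Fin n) (Fin n) K}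
  {C : Matrix m (Fin n) K}

theorem stateSel_mulVec (v : Fin n → K) (i : {i // i ∈ S}) : (stateSel K S *ᵥ v) i = v i := by
  simp [stateSel, Matrix.mulVec, dotProduct]

theorem fits_stateSel : Fits (structIdOn S) (stateSel K S) := by
  intro i j h
  simp only [stateSel, ne_eq, ite_eq_right_iff, one_ne_zero, imp_false, not_not] at h
  simpa [structIdOn] using h

theorem mem_unobs_stateSel {v : Fin n → K} :
    v ∈ unobs A (stateSel K S) ↔ ∀ k : ℕ, ∀ i ∈ S, (A ^ k *ᵥ v) i = 0 := by
  rw [mem_unobs]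
  refine forall_congr' fun k => ⟨fun h i hi => ?_, fun h => funext fun i => ?_⟩
  · have := congrFun h ⟨i, hi⟩
    rwa [stateSel_mulVec] at this
  · rw [stateSel_mulVec]
    exact h i i.2

theorem unobs_stateSel_le (hC : ∀ y i, C y i ≠ 0 → i ∈ S) : unobs A (stateSel K S) ≤ unobs A C := by
  intro v hv k
  rw [mem_unobs_stateSel] at hv
  funext y
  rw [Matrix.mulVec, dotProduct]
  refine Finset.sum_eq_zero fun i _ => ?_
  by_cases h : C y i = 0
  · rw [h, zero_mul]
  · rw [hv k i (hC y i h), mul_zero]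

theorem unobs_le_unobs_stateSel (h : ∀ v ∈ unobs A C, ∀ i ∈ S, v i = 0) :
    unobs A C ≤ unobs A (stateSel K S) := fun _ hv =>
  mem_unobs_stateSel.2 fun k i hi => h _ (pow_mulVec_mem_unobs hv k) i hi

end stateSel

/-! Structural functional observability -/

theorem mem_nonzeroCols {m n : Type} [Fintype m] [Fintype n] {M : StructMat m n} {j : n} :
    j ∈ nonzeroCols M ↔ ∃ i, M i j = true := by simp [nonzeroCols]

theorem Generic.forall {ι σ : Type} [Finite ι] {P : ι → (σ → ℝ) → Prop} (h : ∀ i, Generic (P i)) :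
    Generic fun θ => ∀ i, P i θ := by
  choose g hg hP using h
  have := Fintype.ofFinite ι
  refine ⟨∏ i, g i, Finset.prod_ne_zero_iff.2 fun i _ => hg i, fun θ hθ i => hP i θ ?_⟩
  rw [map_prod] at hθ
  exact Finset.prod_ne_zero_iff.1 hθ i (Finset.mem_univ i)

theorem GenericPair.forall {a b c d ι : Type} [Finite ι] {A : StructMat a b} {C : StructMat c d}
    {P : ι → Matrix a b ℝ → Matrix c d ℝ → Prop} (h : ∀ i, GenericPair A C (P i)) :
    GenericPair A C fun M N => ∀ i, P i M N := Generic.forall h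

/-- This removes the parameters of `F`. A generic realization of `F` and its perturbations in one
free entry all annihilate the unobservable subspace, hence so do their differences, which read
single functional states. -/
theorem isSFO_iff_generic {n p r : ℕ} (A : StructMat (Fin n) (Fin n)) (C : StructMat (Fin p) (Fin n))
    (F : StructMat (Fin r) (Fin n)) :
    IsSFO A C F ↔
      GenericPair A C fun M N => ∀ v ∈ unobs M N, ∀ i ∈ nonzeroCols F, v i = 0 := by
  classical
  unfold IsSFO
  rw [generic_iff_properVariety]
  simp only [functionallyObservable_iff]
  constructor
  · rintro ⟨g, hg, hP⟩
    obtain ⟨θ, hθ⟩ := exists_eval_ne_zero hg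
    let θ₀ : Param A ⊕ Param C → ℝ := Sum.elim (fun e => θ (Sum.inl e))
      (fun e => θ (Sum.inr (Sum.inl e)))
    let ext : (Param A ⊕ Param C → ℝ) → (Param F → ℝ) → (Param A ⊕ Param C ⊕ Param F → ℝ) :=
      fun η φ => Sum.elim (fun e => η (Sum.inl e)) (Sum.elim (fun e => η (Sum.inr e)) φ)
    have spec : ∀ φ : Param F → ℝ, MvPolynomial.eval (ext θ₀ φ) g ≠ 0 →
        GenericPair A C fun M N => ∀ v ∈ unobs M N, realize F φ *ᵥ v = 0 := by
      intro φ hφ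
      let s : Param A ⊕ Param C ⊕ Param F → MvPolynomial (Param A ⊕ Param C) ℝ :=
        Sum.elim (fun e => MvPolynomial.X (Sum.inl e))
          (Sum.elim (fun e => MvPolynomial.X (Sum.inr e)) fun e => MvPolynomial.C (φ e))
      have hs : ∀ η, MvPolynomial.eval η (MvPolynomial.bind₁ s g) =
          MvPolynomial.eval (ext η φ) g := by
        intro η
        have h1 : (fun i => MvPolynomial.eval η (s i)) = ext η φ := by
          funext i
          rcases i with i | i | i <;> simp [s, ext]
        rw [← h1]
        exact MvPolynomial.eval₂Hom_bind₁ _ _ _ _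
      refine ⟨MvPolynomial.bind₁ s g, fun h0 => hφ ?_, fun η hη v hv => ?_⟩
      · rw [← hs, h0, map_zero]
      · rw [hs] at hη
        exact hP _ hη v hv
    let φ₀ : Param F → ℝ := fun e => θ (Sum.inr (Sum.inr e))
    have hφ₀ : MvPolynomial.eval (ext θ₀ φ₀) g ≠ 0 := by
      convert hθ using 2
      congr 1
      funext i
      rcases i with i | i | i <;> rfl
    -- Nonvanishing of `g` is an open condition, so it survives a small nonzero shift of one entry
    -- of `F`.
    have hstep : ∀ f : Param F, ∃ t : ℝ, t ≠ 0 ∧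
        MvPolynomial.eval (ext θ₀ (φ₀ + t • Pi.single f 1)) g ≠ 0 := by
      intro f
      have hcont : Continuous fun t : ℝ =>
          MvPolynomial.eval (ext θ₀ (φ₀ + t • Pi.single f 1)) g := by
        refine (MvPolynomial.continuous_eval g).comp (continuous_pi fun i => ?_)
        rcases i with i | i | i
        · exact continuous_const
        · exact continuous_const
        · simp only [ext, Sum.elim_inr, Pi.add_apply, Pi.smul_apply]
          fun_prop
      have h1 : ∀ᶠ t in nhds (0 : ℝ),
          MvPolynomial.eval (ext θ₀ (φ₀ + t • Pi.single f 1)) g ≠ 0 := by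
        refine hcont.continuousAt.eventually_ne ?_
        simpa using hφ₀
      obtain ⟨t, ht, ht'⟩ := ((h1.filter_mono nhdsWithin_le_nhds).and
        (self_mem_nhdsWithin : {(0 : ℝ)}ᶜ ∈ nhdsWithin 0 {(0 : ℝ)}ᶜ)).exists
      exact ⟨t, ht', ht⟩
    choose t ht0 ht using hstep
    have h1 := (spec φ₀ hφ₀).and (GenericPair.forall fun f => spec _ (ht f))
    refine h1.mono ?_
    rintro M N - - ⟨hv0, hv1⟩ v hv j hj
    obtain ⟨i, hij⟩ := mem_nonzeroCols.1 hj
    have e0 := hv0 v hv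
    have e1 := hv1 ⟨(i, j), hij⟩ v hv
    have e2 : realize F (φ₀ + t ⟨(i, j), hij⟩ • Pi.single ⟨(i, j), hij⟩ 1) =
        realize F φ₀ + Matrix.single i j (t ⟨(i, j), hij⟩) := by
      ext i' j'
      by_cases hij' : i' = i ∧ j' = j
      · obtain ⟨rfl, rfl⟩ := hij'
        simp [realize, hij]
      · have h3 : ¬ (i = i' ∧ j = j') := fun h => hij' ⟨h.1.symm, h.2.symm⟩
        rw [Matrix.add_apply, Matrix.single_apply, if_neg h3, add_zero]
        unfold realize
        split_ifs with hF
        · have h4 : (⟨(i', j'), hF⟩ : Param F) ≠ ⟨(i, j), hij⟩ := by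
            simpa [Prod.ext_iff] using hij'
          simp [Pi.single_eq_of_ne h4]
        · rfl
    rw [e2, Matrix.add_mulVec, e0, zero_add] at e1
    have e3 := congrFun e1 i
    rw [Matrix.single_mulVec] at e3
    simpa [ht0] using e3
  · intro h
    have h1 := Generic.comp h (Sum.elim Sum.inl fun e => Sum.inr (Sum.inl e) :
      Param A ⊕ Param C → Param A ⊕ Param C ⊕ Param F) (by
        rintro (i | i) (j | j) hij <;> simp_all)
    refine Generic.mono h1 fun θ hθ v hv => funext fun i => ?_
    rw [Matrix.mulVec, dotProduct]
    refine Finset.sum_eq_zero fun j _ => ?_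
    by_cases h0 : realize F (fun f => θ (Sum.inr (Sum.inr f))) i j = 0
    · rw [h0, zero_mul]
    · rw [hθ v hv j (mem_nonzeroCols.2 ⟨i, fits_realize _ _ _ _ h0⟩), mul_zero]

/-! ### Sensors supported on the functional states: feasibility as a rank condition -/

section constrained
variable {n p : ℕ} {A : StructMat (Fin n) (Fin n)} {S : Finset (Fin n)}
  {C : StructMat (Fin p) (Fin n)}

theorem Fits.mem_of_nonzeroCols_subset {m K : Type} [Fintype m] [Zero K] {C : StructMat m (Fin n)}
    {N : Matrix m (Fin n) K} (hN : Fits C N) (hC : nonzeroCols C ⊆ S) (y : m) (i : Fin n)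
    (h : N y i ≠ 0) : i ∈ S :=
  hC (mem_nonzeroCols.2 ⟨y, hN y i h⟩)

theorem nonzeroCols_structIdOn : nonzeroCols (structIdOn S) ⊆ S := by
  intro j hj
  obtain ⟨i, hi⟩ := mem_nonzeroCols.1 hj
  have : (i : Fin n) = j := by simpa [structIdOn] using hi
  exact this ▸ i.2

/-- Among the output matrices supported on `S`, the observability matrix of the sensors that read
`S` has the largest rank. -/
theorem rank_obsMat_le_stateSel {m K : Type} [Fintype m] [Field K] {A : Matrix (Fin n) (Fin n) K}
    {C : Matrix m (Fin n) K} (hC : ∀ y i, C y i ≠ 0 → i ∈ S) :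
    (obsMat A C).rank ≤ (obsMat A (stateSel K S)).rank :=
  rank_obsMat_le_of_unobs_le (unobs_stateSel_le hC)

theorem grankObs_le_structIdOn {m : Type} [Fintype m] {C : StructMat m (Fin n)}
    (hC : nonzeroCols C ⊆ S) : grankObs A C ≤ grankObs A (structIdOn S) := by
  obtain ⟨M, N, hM, hN, h⟩ := exists_rank_eq_grankObs A C
  rw [← h]
  exact (rank_obsMat_le_stateSel (hN.mem_of_nonzeroCols_subset hC)).trans
    (rank_le_grankObs hM fits_stateSel)

/-- The free entries of `structIdOn S` may be set to `1`, since no realization of that pattern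
observes more than `stateSel`. The pattern `C` is only carried along, so that this property can be
intersected with generic properties of `(A, C)`. -/
theorem genericPair_stateSel (A : StructMat (Fin n) (Fin n)) (S : Finset (Fin n))
    {c d : Type} (C : StructMat c d) : GenericPair A C fun M _ =>
      (obsMat M (stateSel ℝ S)).rank = grankObs A (structIdOn S) := by
  obtain ⟨M, N, hM, hN, h⟩ := exists_rank_eq_grankObs A (structIdOn S)
  have h1 := rank_obsMat_le_stateSel (A := M)
    (hN.mem_of_nonzeroCols_subset nonzeroCols_structIdOn)
  rw [h] at h1
  have hΦ : ∀ {R R' : Type} [CommRing R] [Algebra ℝ R] [CommRing R'] [Algebra ℝ R']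
      (f : R →ₐ[ℝ] R'), (stateSel R S).map f = stateSel R' S := by
    intro R R' _ _ _ _ f
    ext i j
    simp [stateSel, apply_ite f]
  refine (genericPair_le_rank (M₀ := M) (N₀ := (0 : Matrix c d ℝ)) (C := C)
    (fun {R} _ _ M _ => obsMat M (stateSel R S))
    (fun f M N => ?_) hM (fun i j hij => absurd rfl hij) h1).mono
    fun M N hM hN h => le_antisymm (rank_le_grankObs hM fits_stateSel) h
  have := obsMat_map f.toRingHom M (stateSel _ S)
  rw [← hΦ f]
  exact this

/-- Reading all of `S = X_F` leaves the smallest unobservable subspace among sensors supported on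
`S`. Since that of `C` is `A`-invariant, its elements vanish on `S` exactly when the two subspaces
coincide, and for nested subspaces this is equality of ranks. -/
theorem isSFO_iff_grankObs {r : ℕ} {F : StructMat (Fin r) (Fin n)}
    (hC : nonzeroCols C ⊆ nonzeroCols F) :
    IsSFO A C F ↔ grankObs A (structIdOn (nonzeroCols F)) ≤ grankObs A C := by
  rw [isSFO_iff_generic]
  constructor
  · intro h
    obtain ⟨M, N, hM, hN, h1, h2⟩ := (h.and (genericPair_stateSel A (nonzeroCols F) C)).exists
    rw [← h2]
    exact (rank_obsMat_le_of_unobs_le (unobs_le_unobs_stateSel h1)).trans (rank_le_grankObs hM hN)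
  · intro h
    refine (genericPair_rank_eq_grankObs A C).mono fun M N hM hN h1 v hv i hi => ?_
    have h2 := unobs_eq_of_rank_le
      (unobs_stateSel_le (A := M) (hN.mem_of_nonzeroCols_subset hC)) (by
        rw [h1]
        exact (rank_le_grankObs hM fits_stateSel).trans h)
    rw [← h2, mem_unobs_stateSel] at hv
    simpa using hv 0 i hi

end constrained

/-! The iterative algorithm -/

section iterative
variable {n r : ℕ} {A : StructMat (Fin n) (Fin n)} {F : StructMat (Fin r) (Fin n)}

theorem loopState_apply (F : StructMat (Fin r) (Fin n)) (k : ℕ) (i : Fin k) :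
    loopState F k i = eta F := by
  induction k with
  | zero => exact i.elim0
  | succ k ih =>
    refine Fin.lastCases ?_ (fun i => ?_) i
    · exact Fin.snoc_last (α := fun _ => Fin n → Bool) _ _
    · exact (Fin.snoc_castSucc (α := fun _ => Fin n → Bool) _ _ _).trans (ih i)

theorem loopState_eq_true {k : ℕ} {i : Fin k} {j : Fin n} :
    loopState F k i j = true ↔ j ∈ nonzeroCols F := by
  rw [loopState_apply, eta, decide_eq_true_iff]

theorem nonzeroCols_loopState (F : StructMat (Fin r) (Fin n)) (k : ℕ) :
    nonzeroCols (loopState F k) ⊆ nonzeroCols F := fun _ hj =>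
  let ⟨_, hi⟩ := mem_nonzeroCols.1 hj
  loopState_eq_true.1 hi

theorem grankObs_le_loopState {p : ℕ} {C : StructMat (Fin p) (Fin n)}
    (hC : nonzeroCols C ⊆ nonzeroCols F) : grankObs A C ≤ grankObs A (loopState F p) := by
  obtain ⟨M, N, hM, hN, h⟩ := exists_rank_eq_grankObs A C
  rw [← h]
  exact rank_le_grankObs hM fun i j hij =>
    loopState_eq_true.2 (hN.mem_of_nonzeroCols_subset hC i j hij)

theorem isSFO_loopState_of_isSFO {p : ℕ} {C : StructMat (Fin p) (Fin n)} (h : IsSFO A C F)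
    (hC : nonzeroCols C ⊆ nonzeroCols F) : IsSFO A (loopState F p) F := by
  rw [isSFO_iff_grankObs hC] at h
  rw [isSFO_iff_grankObs (nonzeroCols_loopState F p)]
  exact h.trans (grankObs_le_loopState hC)

theorem exists_isSFO_loopState (A : StructMat (Fin n) (Fin n)) (F : StructMat (Fin r) (Fin n)) :
    ∃ p, IsSFO A (loopState F p) F := by
  refine ⟨(nonzeroCols F).card, ?_⟩
  rw [isSFO_iff_grankObs (nonzeroCols_loopState F _)]
  obtain ⟨M, N, hM, hN, h⟩ := exists_rank_eq_grankObs A (structIdOn (nonzeroCols F))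
  let e := (nonzeroCols F).equivFin.symm
  have hfit : Fits (loopState F (nonzeroCols F).card) (N.submatrix e id) := fun i j hij =>
    loopState_eq_true.2 (hN.mem_of_nonzeroCols_subset nonzeroCols_structIdOn (e i) j hij)
  rw [← h]
  refine (rank_obsMat_le_of_unobs_le fun v hv k => ?_).trans (rank_le_grankObs hM hfit)
  funext i
  have := congrFun (hv k) (e.symm i)
  simpa [Matrix.mulVec, dotProduct] using this

/-- If appending `F` does not raise the generic rank, it does not shrink the generic unobservable
subspace, so `F` vanishes there. Conversely `[C; F]` is still supported on `X_F`, so a feasible `C`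
already attains its rank. -/
theorem loopGuard_iff {p : ℕ} {C : StructMat (Fin p) (Fin n)}
    (hC : nonzeroCols C ⊆ nonzeroCols F) : LoopGuard A F C ↔ ¬ IsSFO A C F := by
  rw [LoopGuard, ← not_iff_not, not_not]
  have hle : ¬ (1 : ℤ) ≤ (grankObs A (Matrix.fromRows C F) : ℤ) - (grankObs A C : ℤ) ↔
      grankObs A (Matrix.fromRows C F) ≤ grankObs A C := by omega
  rw [hle]
  constructor
  · intro h
    unfold IsSFO
    rw [generic_iff_properVariety]
    have h1 := Generic.comp (genericPair_rank_eq_grankObs A C)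
      (Sum.elim Sum.inl fun e => Sum.inr (Sum.inl e) :
        Param A ⊕ Param C → Param A ⊕ Param C ⊕ Param F) (by
          rintro (i | i) (j | j) hij <;> simp_all)
    refine Generic.mono h1 fun θ hθ => functionallyObservable_iff.2 fun v hv => ?_
    simp only [Function.comp_def, Sum.elim_inl, Sum.elim_inr] at hθ
    generalize hF : realize F (fun f => θ (Sum.inr (Sum.inr f))) = K
    have hK : Fits F K := hF ▸ fits_realize _ _
    have hM := fits_realize A fun a => θ (Sum.inl a)
    have hN := fits_realize C fun c => θ (Sum.inr (Sum.inl c))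
    generalize realize A (fun a => θ (Sum.inl a)) = M at *
    generalize realize C (fun c => θ (Sum.inr (Sum.inl c))) = N at *
    have hfit : Fits (Matrix.fromRows C F) (Matrix.fromRows N K) := by
      rintro (i | i) j hij
      · exact hN i j hij
      · exact hK i j hij
    have hsub : unobs M (Matrix.fromRows N K) ≤ unobs M N := by
      intro w hw k
      have := hw k
      rw [Matrix.fromRows_mulVec] at this
      funext i
      exact congrFun this (Sum.inl i)
    have heq := unobs_eq_of_rank_le hsub (by
      rw [hθ]
      exact (rank_le_grankObs hM hfit).trans h)
    rw [← heq] at hv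
    have := mulVec_eq_zero_of_mem_unobs hv
    rw [Matrix.fromRows_mulVec] at this
    funext i
    exact congrFun this (Sum.inr i)
  · intro h
    rw [isSFO_iff_grankObs hC] at h
    refine (grankObs_le_structIdOn fun j hj => ?_).trans h
    obtain ⟨i | i, hi⟩ := mem_nonzeroCols.1 hj
    · exact hC (mem_nonzeroCols.2 ⟨i, hi⟩)
    · exact mem_nonzeroCols.2 ⟨i, hi⟩

theorem exists_iterativeReturns (A : StructMat (Fin n) (Fin n)) (F : StructMat (Fin r) (Fin n)) :
    ∃ (p : ℕ) (C : StructMat (Fin p) (Fin n)), IterativeReturns A F C := by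
  classical
  have h := exists_isSFO_loopState A F
  refine ⟨Nat.find h, _, rfl, ?_, fun k hk => ?_⟩
  · rw [loopGuard_iff (nonzeroCols_loopState F _), not_not]
    exact Nat.find_spec h
  · rw [loopGuard_iff (nonzeroCols_loopState F _)]
    exact Nat.find_min h hk

theorem IterativeReturns.isConstrainedOptimal {p : ℕ} {C : StructMat (Fin p) (Fin n)}
    (h : IterativeReturns A F C) : IsConstrainedOptimal A F C := by
  obtain ⟨rfl, h1, h2⟩ := h
  rw [loopGuard_iff (nonzeroCols_loopState F _), not_not] at h1
  refine ⟨h1, nonzeroCols_loopState F _, fun p' C' h' hC' => ?_⟩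
  by_contra! hlt
  have := h2 p' hlt
  rw [loopGuard_iff (nonzeroCols_loopState F _)] at this
  exact this (isSFO_loopState_of_isSFO h' hC')

end iterative

/-! Generically diagonalizable systems -/

/-- A linear map to `K ^ p` may be chosen injective on each of finitely many subspaces of dimension
at most `p`. -/
theorem exists_linearMap_injOn {K V : Type} [Field K] [Infinite K] [AddCommGroup V] [Module K V]
    [FiniteDimensional K V] (p : ℕ) (s : Finset (Submodule K V))
    (hs : ∀ W ∈ s, Module.finrank K W ≤ p) :
    ∃ D : V →ₗ[K] Fin p → K, ∀ W ∈ s, ∀ v ∈ W, D v = 0 → v = 0 := by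
  classical
  induction p generalizing s with
  | zero =>
    refine ⟨0, fun W hW v hv _ => ?_⟩
    have : W = ⊥ := Submodule.finrank_eq_zero.1 (Nat.le_zero.1 (hs W hW))
    simpa [this] using hv
  | succ p ih =>
    -- The first coordinate `φ` is chosen outside the annihilators of all nonzero `W`, which is
    -- possible over an infinite field. Intersecting with `ker φ` then lowers every such dimension,
    -- and the induction supplies the other coordinates.
    let t : Finset (Submodule K (Module.Dual K V)) :=
      (s.filter (· ≠ ⊥)).image Submodule.dualAnnihilator
    have ht : (⊤ : Submodule K (Module.Dual K V)) ∉ t := by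
      intro h
      obtain ⟨W, hW, hW'⟩ := Finset.mem_image.1 h
      refine (Finset.mem_filter.1 hW).2 ?_
      rw [eq_bot_iff]
      intro v hv
      rw [Submodule.mem_bot]
      refine (Module.forall_dual_apply_eq_zero_iff K v).1 fun φ => ?_
      have h1 : φ ∈ W.dualAnnihilator := hW' ▸ Submodule.mem_top
      exact (Submodule.mem_dualAnnihilator φ).1 h1 v hv
    obtain ⟨φ, hφ⟩ := (Set.ne_univ_iff_exists_notMem _).1
      (Subspace.biUnion_ne_univ_of_top_notMem ht)
    obtain ⟨D, hD⟩ := ih (s.image (· ⊓ LinearMap.ker φ)) (by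
      intro U hU
      obtain ⟨W, hW, rfl⟩ := Finset.mem_image.1 hU
      by_cases hbot : W = ⊥
      · rw [hbot, bot_inf_eq, finrank_bot]
        exact Nat.zero_le _
      · have hlt : W ⊓ LinearMap.ker φ < W := by
          refine lt_of_le_of_ne inf_le_left fun heq => hφ ?_
          refine Set.mem_biUnion (Finset.mem_coe.2 (Finset.mem_image.2
            ⟨W, Finset.mem_filter.2 ⟨hW, hbot⟩, rfl⟩)) ?_
          refine (Submodule.mem_dualAnnihilator φ).2 fun w hw => ?_
          rw [← heq] at hw
          exact hw.2
        have h1 := Submodule.finrank_lt_finrank_of_lt hlt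
        have h2 := hs W hW
        omega)
    refine ⟨LinearMap.pi (Fin.cons φ fun i => LinearMap.proj i ∘ₗ D), fun W hW v hv h0 => ?_⟩
    have h1 : φ v = 0 := congrFun h0 0
    refine hD _ (Finset.mem_image_of_mem _ hW) v ⟨hv, h1⟩ (funext fun i => ?_)
    exact congrFun h0 i.succ

theorem iSup_eigenspace_eq_top_of_diagonalizable {n : ℕ} {A : Matrix (Fin n) (Fin n) ℝ}
    (h : Diagonalizable A) :
    ⨆ μ, Module.End.eigenspace (Matrix.mulVecLin (A.map Complex.ofReal)) μ = ⊤ := by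
  obtain ⟨P, d, hP, h⟩ := h
  rw [eq_top_iff]
  intro v _
  have hv : v = P *ᵥ (P⁻¹ *ᵥ v) := by
    rw [Matrix.mulVec_mulVec, Matrix.mul_nonsing_inv _ ((Matrix.isUnit_iff_isUnit_det P).1 hP),
      Matrix.one_mulVec]
  rw [hv, Matrix.mulVec_eq_sum]
  refine Submodule.sum_mem _ fun j _ => ?_
  rw [op_smul_eq_smul]
  refine Submodule.smul_mem _ _ (Submodule.mem_iSup_of_mem (d j) ?_)
  refine Module.End.mem_eigenspace_iff.2 ?_
  funext i
  have h1 := congrFun (congrFun h i) j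
  rw [Matrix.mul_diagonal] at h1
  rw [Matrix.mulVecLin_apply, Pi.smul_apply, smul_eq_mul, mul_comm]
  exact h1

/-- For real `A` and `C`, the real and imaginary parts of an unobservable complex vector are
unobservable. -/
theorem apply_eq_zero_of_mem_unobs_complex {m : Type} {n : ℕ} {A : Matrix (Fin n) (Fin n) ℝ}
    {C : Matrix m (Fin n) ℝ} {i : Fin n} (h : ∀ v ∈ unobs A C, v i = 0) {v : Fin n → ℂ}
    (hv : v ∈ unobs (A.map Complex.ofReal) (C.map Complex.ofReal)) : v i = 0 := by
  have key : ∀ (k : ℕ) (y : m), (∑ j, ((C * A ^ k) y j : ℂ) * v j) = 0 := by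
    intro k y
    have h1 := congrFun (hv k) y
    rw [Matrix.mulVec_mulVec] at h1
    have h2 : C.map Complex.ofReal * A.map Complex.ofReal ^ k =
        (C * A ^ k).map Complex.ofRealHom := by
      rw [Matrix.map_mul, Matrix.map_pow]
      rfl
    rw [h2] at h1
    exact h1
  have hre : (fun j => (v j).re) ∈ unobs A C := fun k => by
    funext y
    rw [Matrix.mulVec_mulVec]
    have := congrArg Complex.re (key k y)
    simpa [Matrix.mulVec, dotProduct] using this
  have him : (fun j => (v j).im) ∈ unobs A C := fun k => by
    funext y
    rw [Matrix.mulVec_mulVec]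
    have := congrArg Complex.im (key k y)
    simpa [Matrix.mulVec, dotProduct] using this
  exact Complex.ext (h _ hre) (h _ him)

/-- For diagonalizable `A` it suffices to observe the functional part of each eigenspace separately.
The given `C` bounds the dimensions of these parts by `p`, so a single map `D` to `ℂ ^ p` is
injective on all of them, and `D` after reading `S` fits the pattern of `loopState F p`. -/
theorem isSFO_loopState_of_genericallyDiagonalizable {n p r : ℕ} {A : StructMat (Fin n) (Fin n)}
    {F : StructMat (Fin r) (Fin n)} {C : StructMat (Fin p) (Fin n)}
    (hA : GenericallyDiagonalizable A) (h : IsSFO A C F) : IsSFO A (loopState F p) F := by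
  classical
  rw [isSFO_iff_grankObs (nonzeroCols_loopState F p)]
  rw [isSFO_iff_generic] at h
  have hd : GenericPair A C fun M _ => Diagonalizable M :=
    Generic.comp ((generic_iff_properVariety _).1 hA) Sum.inl Sum.inl_injective
  obtain ⟨M, N, hM, hN, hMN, hMd, hMr⟩ :=
    (h.and (hd.and (genericPair_stateSel A (nonzeroCols F) C))).exists
  set S := nonzeroCols F
  set Mc := M.map Complex.ofReal
  set Nc := N.map Complex.ofReal
  have hMc : Fits A Mc := fun i j hij => hM i j fun h0 => hij (by simp [Mc, h0])
  have hobs : ∀ v ∈ unobs Mc Nc, ∀ i ∈ S, v i = 0 := fun v hv i hi =>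
    apply_eq_zero_of_mem_unobs_complex (fun w hw => hMN w hw i hi) hv
  let f : Module.End ℂ (Fin n → ℂ) := Mc.mulVecLin
  let R : ℂ → Submodule ℂ ({i // i ∈ S} → ℂ) := fun μ =>
    (f.eigenspace μ).map (stateSel ℂ S).mulVecLin
  have hpow : ∀ μ, ∀ v ∈ f.eigenspace μ, ∀ k : ℕ, Mc ^ k *ᵥ v = μ ^ k • v := by
    intro μ v hv k
    have hv' : Mc *ᵥ v = μ • v := Module.End.mem_eigenspace_iff.1 hv
    induction k with
    | zero => simp
    | succ k ih => rw [pow_succ', ← Matrix.mulVec_mulVec, ih, Matrix.mulVec_smul, hv', smul_smul,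
        pow_succ]
  -- An eigenvector killed by `Nc` is unobservable, hence vanishes on `S`; so on an eigenspace,
  -- reading `S` has rank at most that of `Nc`.
  have hR : ∀ μ, Module.finrank ℂ (R μ) ≤ p := by
    intro μ
    let g := (stateSel ℂ S).mulVecLin.domRestrict (f.eigenspace μ)
    let g' := Nc.mulVecLin.domRestrict (f.eigenspace μ)
    have hker : LinearMap.ker g' ≤ LinearMap.ker g := by
      rintro ⟨v, hv⟩ hv0
      have hv0' : Nc *ᵥ v = 0 := hv0
      have hvU : v ∈ unobs Mc Nc := fun k => by
        rw [hpow μ v hv, Matrix.mulVec_smul, hv0', smul_zero]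
      refine LinearMap.mem_ker.2 (funext fun i => ?_)
      exact (stateSel_mulVec v i).trans (hobs v hvU i i.2)
    have e1 := LinearMap.finrank_range_add_finrank_ker g
    have e2 := LinearMap.finrank_range_add_finrank_ker g'
    have e3 := Submodule.finrank_mono hker
    have e4 : Module.finrank ℂ (LinearMap.range g') ≤ p := by
      simpa using Submodule.finrank_le (LinearMap.range g')
    have e5 : R μ = LinearMap.range g := (LinearMap.range_domRestrict _ _).symm
    rw [e5]
    omega
  obtain ⟨D, hD⟩ := exists_linearMap_injOn p
    ((Module.End.finite_hasEigenvalue f).toFinset.image R) (by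
      intro W hW
      obtain ⟨μ, -, rfl⟩ := Finset.mem_image.1 hW
      exact hR μ)
  let Cc : Matrix (Fin p) (Fin n) ℂ := LinearMap.toMatrix' D * stateSel ℂ S
  have hCc : ∀ v, Cc *ᵥ v = D (stateSel ℂ S *ᵥ v) := by
    intro v
    rw [← Matrix.mulVec_mulVec, LinearMap.toMatrix'_mulVec]
  have hfit : Fits (loopState F p) Cc := by
    intro i j hij
    rw [loopState_eq_true]
    by_contra hj
    refine hij (Matrix.mul_apply.trans ?_)
    refine Finset.sum_eq_zero fun s _ => ?_
    have : (s : Fin n) ≠ j := fun h0 => hj (h0 ▸ s.2)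
    simp [stateSel, this]
  refine le_grankObs hMc hfit (K := ℂ) ?_
  rw [← hMr]
  have hmap : (obsMat M (stateSel ℝ S)).map Complex.ofRealHom = obsMat Mc (stateSel ℂ S) := by
    rw [obsMat_map]
    congr 1
    ext i j
    simp [stateSel, apply_ite]
  have hrank := le_rank_map Complex.ofRealHom (obsMat M (stateSel ℝ S)) le_rfl
  rw [hmap] at hrank
  refine hrank.trans (rank_obsMat_le_of_unobs_le (unobs_le_unobs_stateSel fun v hv i hi => ?_))
  have htop := iSup_eigenspace_eq_top_of_diagonalizable hMd
  -- The unobservable subspace is invariant, hence the sum of its intersections with the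
  -- eigenspaces; only eigenvectors need to be tested.
  have hinf := Submodule.inf_iSup_genEigenspace (f := f) (p := unobs Mc Cc)
    (fun x hx => mulVec_mem_unobs hx) 1
  have hle : unobs Mc Cc ≤ LinearMap.ker (LinearMap.proj (R := ℂ) (φ := fun _ : Fin n => ℂ) i) := by
    have htop' : ⨆ μ, (f.genEigenspace μ) 1 = ⊤ := htop
    rw [htop', inf_top_eq] at hinf
    rw [hinf]
    refine iSup_le fun μ w hw => ?_
    have hwE : w ∈ f.eigenspace μ := hw.2
    rw [LinearMap.mem_ker, LinearMap.proj_apply]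
    by_cases hw0 : w = 0
    · simp [hw0]
    have hμ : f.HasEigenvalue μ :=
      Module.End.hasEigenvalue_of_hasEigenvector ⟨hwE, hw0⟩
    have h0 := mulVec_eq_zero_of_mem_unobs hw.1
    rw [hCc] at h0
    have h1 := hD (R μ) (Finset.mem_image_of_mem _ ((Set.Finite.mem_toFinset _).2 hμ)) _
      (Submodule.mem_map_of_mem hwE) h0
    have h2 := congrFun h1 ⟨i, hi⟩
    exact (stateSel_mulVec w ⟨i, hi⟩).symm.trans h2
  exact hle hv

/-- Under generic diagonalizability, sensors on the functional states are as good as any. -/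
theorem IsConstrainedOptimal.isOptimal_of_genericallyDiagonalizable {n p r : ℕ}
    {A : StructMat (Fin n) (Fin n)} {F : StructMat (Fin r) (Fin n)} {C : StructMat (Fin p) (Fin n)}
    (h : IsConstrainedOptimal A F C) (hA : GenericallyDiagonalizable A) : IsOptimal A F C :=
  ⟨h.1, fun p' _ h' => h.2.2 p' _ (isSFO_loopState_of_genericallyDiagonalizable hA h')
    (nonzeroCols_loopState F p')⟩

/-- Every column of `F` is nonzero, so every competitor satisfies the support constraint. -/
theorem IsConstrainedOptimal.isOptimal_of_structId {n p r : ℕ}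
    {A : StructMat (Fin n) (Fin n)} {F : StructMat (Fin r) (Fin n)} {C : StructMat (Fin p) (Fin n)}
    (h : IsConstrainedOptimal A F C) (hr : r = n)
    (hF : F = (structId n).submatrix (Fin.cast hr) id) : IsOptimal A F C := by
  refine ⟨h.1, fun p' C' h' => h.2.2 p' C' h' fun j _ => mem_nonzeroCols.2 ⟨Fin.cast hr.symm j, ?_⟩⟩
  simp [hF, structId]

/-! Linkings, and the upper bound for the rank of the observability matrix -/

/-- An injective map of the states to states and outputs that follows the edges `E` (`E v i`: an
edge from `x_i` to `v`) except where it fixes a state. -/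
def IsLinking {n : ℕ} {m : Type} (E : Fin n ⊕ m → Fin n → Prop) (f : Fin n → Fin n ⊕ m) : Prop :=
  Function.Injective f ∧ ∀ i, E (f i) i ∨ f i = Sum.inl i

open Classical in
/-- The number of states that a linking covers by edges. -/
def linkSize {n : ℕ} {m : Type} (E : Fin n ⊕ m → Fin n → Prop) (f : Fin n → Fin n ⊕ m) : ℕ :=
  (Finset.univ.filter fun i => E (f i) i).card

theorem exists_perm_not_dvd_prod {V R : Type} [Fintype V] [DecidableEq V] [CommRing R]
    (M : Matrix V V R) (a : R) (h : ¬ a ∣ M.det) :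
    ∃ σ : Equiv.Perm V, ¬ a ∣ ∏ v, M (σ v) v := by
  by_contra! h'
  refine h ?_
  rw [Matrix.det_apply']
  exact Finset.dvd_sum fun σ _ => (h' σ).mul_left _

section upper
variable {K m : Type} [Field K] {n : ℕ} {A : Matrix (Fin n) (Fin n) K}
  {C : Matrix m (Fin n) K}

/-- By the Schur complement, `det [[X - A, G], [C, 1]]` is the characteristic polynomial of `A + G *
C`. A permutation whose Leibniz term is not divisible by `X ^ (d + 1)` restricts on the state
columns to a linking; a column that follows no edge must use a diagonal entry equal to `X`, so there
are at most `d` of them. -/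
theorem exists_linking_of_not_dvd_charpoly [Fintype m] [DecidableEq m] {G : Matrix (Fin n) m K}
    {d : ℕ} (h : ¬ (Polynomial.X ^ (d + 1) : Polynomial K) ∣ (A + G * C).charpoly) :
    ∃ f, IsLinking (fun v i => Matrix.fromRows A C v i ≠ 0) f ∧
      n ≤ linkSize (fun v i => Matrix.fromRows A C v i ≠ 0) f + d := by
  classical
  let M := Matrix.fromBlocks A.charmatrix (G.map Polynomial.C) (C.map Polynomial.C) 1
  have hM : M.det = (A + G * C).charpoly := by
    rw [Matrix.det_fromBlocks_one₂₂, Matrix.charpoly]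
    congr 1
    ext1 i j
    simp [Matrix.charmatrix_apply, Matrix.mul_apply, sub_sub]
  rw [← hM] at h
  obtain ⟨σ, hσ⟩ := exists_perm_not_dvd_prod M _ h
  have hne : ∀ v, M (σ v) v ≠ 0 := fun v hv => by
    have h0 : ∏ v, M (σ v) v = 0 := Finset.prod_eq_zero (Finset.mem_univ v) hv
    exact hσ (h0 ▸ dvd_zero _)
  have hX : ∀ i, Matrix.fromRows A C (σ (Sum.inl i)) i = 0 →
      σ (Sum.inl i) = Sum.inl i ∧ M (σ (Sum.inl i)) (Sum.inl i) = Polynomial.X := by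
    intro i hi
    have h1 := hne (Sum.inl i)
    rcases hs : σ (Sum.inl i) with j | y
    · rw [hs] at h1 hi
      have hA : A j i = 0 := hi
      have h2 : M (Sum.inl j) (Sum.inl i) = A.charmatrix j i := rfl
      by_cases hij : j = i
      · subst hij
        rw [h2, Matrix.charmatrix_apply_eq, hA]
        simp
      · rw [h2, Matrix.charmatrix_apply_ne _ _ _ hij, hA] at h1
        simp at h1
    · rw [hs] at h1 hi
      have hC : C y i = 0 := hi
      have h2 : M (Sum.inr y) (Sum.inl i) = Polynomial.C (C y i) := rfl
      rw [h2, hC] at h1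
      simp at h1
  refine ⟨fun i => σ (Sum.inl i), ⟨fun i j hij => Sum.inl_injective (σ.injective hij),
    fun i => ?_⟩, ?_⟩
  · by_cases hi : Matrix.fromRows A C (σ (Sum.inl i)) i = 0
    · exact Or.inr (hX i hi).1
    · exact Or.inl hi
  · have hcard := Finset.card_filter_add_card_filter_not (s := (Finset.univ : Finset (Fin n)))
      (fun i => Matrix.fromRows A C (σ (Sum.inl i)) i ≠ 0)
    rw [Finset.card_univ, Fintype.card_fin] at hcard
    set Z := Finset.univ.filter fun i => ¬ Matrix.fromRows A C (σ (Sum.inl i)) i ≠ 0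
    have hdvd : (Polynomial.X ^ Z.card : Polynomial K) ∣ ∏ v, M (σ v) v := by
      rw [Fintype.prod_sum_type]
      refine Dvd.dvd.mul_right ?_ _
      rw [← Finset.prod_const]
      refine (Finset.prod_congr rfl fun i hi => ?_).dvd.trans
        (Finset.prod_dvd_prod_of_subset Z _ _ (Finset.subset_univ _))
      exact (hX i (not_not.1 (Finset.mem_filter.1 hi).2)).2.symm
    have hle : Z.card ≤ d := by
      by_contra! hlt
      exact hσ ((pow_dvd_pow _ hlt).trans hdvd)
    have hl : linkSize (fun v i => Matrix.fromRows A C v i ≠ 0) (fun i => σ (Sum.inl i)) =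
        (Finset.univ.filter fun i => Matrix.fromRows A C (σ (Sum.inl i)) i ≠ 0).card := by
      unfold linkSize
      congr!
    omega

theorem not_X_pow_dvd_charpoly {B : Matrix (Fin n) (Fin n) K} {d : ℕ}
    (hd : Module.finrank K (Module.End.maxGenEigenspace B.mulVecLin 0) ≤ d) :
    ¬ (Polynomial.X ^ (d + 1) : Polynomial K) ∣ B.charpoly := by
  intro h
  have h1 := LinearMap.finrank_maxGenEigenspace_eq B.mulVecLin 0
  rw [← Matrix.toLin'_apply', Matrix.charpoly_toLin'] at h1
  rw [← Matrix.toLin'_apply'] at hd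
  have h2 := (Polynomial.le_rootMultiplicity_iff (a := 0) (n := d + 1)
    B.charpoly_monic.ne_zero).2 (by simpa using h)
  omega

/-- An output injection for which all zero modes are unobservable. -/
theorem exists_gain [Fintype m] (A : Matrix (Fin n) (Fin n) K) (C : Matrix m (Fin n) K) :
    ∃ G : Matrix (Fin n) m K, ∀ v, (A + G * C) *ᵥ v ∈ unobs A C → v ∈ unobs A C := by
  classical
  set U := unobs A C with hU
  let a := A.mulVecLin
  let c := C.mulVecLin
  let W := U.comap a
  have hUW : U ≤ W := fun v hv =>
    Submodule.mem_comap.2 (mulVec_mem_unobs hv : A *ᵥ v ∈ unobs A C)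
  have hWU : ∀ v ∈ W, C *ᵥ v = 0 → v ∈ U := by
    intro v hv hv0 k
    cases k with
    | zero => simpa using hv0
    | succ k =>
      have := hv k
      rwa [pow_succ, ← Matrix.mulVec_mulVec]
  -- `G` embeds `C W` into a complement `Z` of `range A + U`. If `(A + G C) v ∈ U`, then `G C v`
  -- lies in `Z` and in `range A + U`, hence is zero; so `v ∈ W` and `C v = 0`, which puts `v` in
  -- `U`. Rank–nullity shows that `Z` is large enough.
  obtain ⟨Z, hZ⟩ := Submodule.exists_isCompl (LinearMap.range a ⊔ U)
  have hdim : Module.finrank K (W.map c) ≤ Module.finrank K Z := by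
    have e1 := Submodule.finrank_add_eq_of_isCompl hZ
    have e2 := Submodule.finrank_sup_add_finrank_inf_eq (LinearMap.range a) U
    have e3 := LinearMap.finrank_range_add_finrank_ker a
    have e4 := LinearMap.finrank_range_add_finrank_ker (a.domRestrict W)
    have e5 := LinearMap.finrank_range_add_finrank_ker (c.domRestrict W)
    have e6 : Module.finrank K (LinearMap.ker (a.domRestrict W)) =
        Module.finrank K (LinearMap.ker a) := by
      rw [LinearMap.ker_domRestrict]
      refine (Submodule.submoduleOfEquivOfLe fun v hv => ?_).finrank_eq
      change a v ∈ U
      rw [LinearMap.mem_ker.1 hv]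
      exact U.zero_mem
    have e7 : Module.finrank K (LinearMap.ker (c.domRestrict W)) = Module.finrank K U := by
      have h1 : LinearMap.ker (c.domRestrict W) = U.submoduleOf W := by
        ext ⟨v, hv⟩
        rw [LinearMap.mem_ker]
        exact ⟨hWU v hv, fun h => mulVec_eq_zero_of_mem_unobs h⟩
      rw [h1, (Submodule.submoduleOfEquivOfLe hUW).finrank_eq]
    rw [LinearMap.range_domRestrict] at e4 e5
    rw [Submodule.map_comap_eq] at e4
    omega
  obtain ⟨e, he⟩ := finrank_le_iff_exists_linearMap.1 hdim
  obtain ⟨g, hg⟩ := LinearMap.exists_extend e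
  refine ⟨LinearMap.toMatrix' (Z.subtype ∘ₗ g), fun v hv => ?_⟩
  have h1 : (A + LinearMap.toMatrix' (Z.subtype ∘ₗ g) * C) *ᵥ v = a v + (g (c v) : Fin n → K) := by
    rw [Matrix.add_mulVec, ← Matrix.mulVec_mulVec, LinearMap.toMatrix'_mulVec]
    rfl
  rw [h1] at hv
  have h2 : g (c v) = 0 := by
    have h3 : (g (c v) : Fin n → K) ∈ LinearMap.range a ⊔ U := by
      have h4 := Submodule.sub_mem _ (Submodule.mem_sup_right hv)
        (Submodule.mem_sup_left (T := U) (LinearMap.mem_range_self a v))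
      simpa using h4
    have h5 := hZ.disjoint.le_bot ⟨h3, (g (c v)).2⟩
    exact Subtype.ext (by simpa using h5)
  rw [h2, Submodule.coe_zero, add_zero] at hv
  refine hWU v hv ?_
  have h6 : e ⟨c v, Submodule.mem_map_of_mem hv⟩ = 0 := by
    rw [← h2, ← hg]
    rfl
  have h7 := (map_eq_zero_iff e he).1 h6
  exact congrArg Subtype.val h7

/-- The rank of the observability matrix is at most the size of a linking. -/
theorem exists_linking_rank_le [Fintype m] (A : Matrix (Fin n) (Fin n) K) (C : Matrix m (Fin n) K) :
    ∃ f, IsLinking (fun v i => Matrix.fromRows A C v i ≠ 0) f ∧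
      (obsMat A C).rank ≤ linkSize (fun v i => Matrix.fromRows A C v i ≠ 0) f := by
  classical
  obtain ⟨G, hG⟩ := exists_gain A C
  have hle : Module.End.maxGenEigenspace (A + G * C).mulVecLin 0 ≤ unobs A C := by
    intro v hv
    obtain ⟨k, hk⟩ := Module.End.mem_maxGenEigenspace _ _ _ |>.1 hv
    rw [zero_smul, sub_zero] at hk
    have key : ∀ (k : ℕ) (w : Fin n → K), ((A + G * C).mulVecLin ^ k) w ∈ unobs A C →
        w ∈ unobs A C := by
      intro k
      induction k with
      | zero => exact fun w hw => hw
      | succ k ih =>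
        intro w hw
        rw [pow_succ, Module.End.mul_apply] at hw
        exact hG w (ih _ hw)
    exact key k v (hk ▸ Submodule.zero_mem _)
  obtain ⟨f, hf, hn⟩ := exists_linking_of_not_dvd_charpoly
    (not_X_pow_dvd_charpoly (Submodule.finrank_mono hle))
  refine ⟨f, hf, ?_⟩
  have := rank_obsMat A C
  omega

/-- The rank of `A ^ n` is at most the number of states covered by disjoint cycles. -/
theorem exists_perm_rank_pow_le (A : Matrix (Fin n) (Fin n) K) [DecidableEq K] :
    ∃ σ : Equiv.Perm (Fin n), (∀ i, A (σ i) i ≠ 0 ∨ σ i = i) ∧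
      (A ^ n).rank ≤ (Finset.univ.filter fun i => A (σ i) i ≠ 0).card := by
  classical
  -- Without outputs, a linking is an injective self-map of the states, that is, a permutation.
  let C : Matrix (Fin 0) (Fin n) K := 0
  have hrank : (A ^ n).rank + Module.finrank K (Module.End.maxGenEigenspace A.mulVecLin 0) = n := by
    have h1 := LinearMap.finrank_range_add_finrank_ker (A ^ n).mulVecLin
    rw [Module.End.maxGenEigenspace_eq_genEigenspace_finrank, Module.End.genEigenspace_nat,
      zero_smul, sub_zero]
    have h2 : A.mulVecLin ^ Module.finrank K (Fin n → K) = (A ^ n).mulVecLin := by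
      rw [Module.finrank_fin_fun, ← Matrix.toLin'_apply', ← Matrix.toLin'_apply', Matrix.toLin'_pow]
    rw [h2]
    simpa [Matrix.rank] using h1
  obtain ⟨f, ⟨hf, hE⟩, hn⟩ := exists_linking_of_not_dvd_charpoly (A := A) (C := C) (G := 0)
    (d := Module.finrank K (Module.End.maxGenEigenspace A.mulVecLin 0)) (by
      rw [Matrix.zero_mul, add_zero]
      exact not_X_pow_dvd_charpoly le_rfl)
  have hg : ∀ i, ∃ j, f i = Sum.inl j := by
    intro i
    rcases f i with j | y
    · exact ⟨j, rfl⟩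
    · exact y.elim0
  choose g hg using hg
  have hgi : Function.Injective g := fun i j hij => hf (by rw [hg, hg, hij])
  refine ⟨Equiv.ofBijective g (Finite.injective_iff_bijective.1 hgi), fun i => ?_, ?_⟩
  · have := hE i
    rw [hg i, Sum.inl.injEq] at this
    exact this
  · have h3 : linkSize (fun v i => Matrix.fromRows A C v i ≠ 0) f =
        (Finset.univ.filter fun i => A (g i) i ≠ 0).card := by
      unfold linkSize
      congr 1
      ext i
      simp [hg i]
    rw [h3] at hn
    simp only [Equiv.ofBijective_apply]
    omega

end upper

/-! Ingredients of the lower bound for the generic rank -/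

theorem card_le_rank_of_injOn_support {K a : Type} [Field K] [Fintype a] {n : ℕ}
    (B : Matrix a (Fin n) K) (T : Finset (Fin n))
    (h : ∀ v, (∀ i ∉ T, v i = 0) → B *ᵥ v = 0 → v = 0) : T.card ≤ B.rank := by
  classical
  let B' := B.submatrix id (fun i : {i // i ∈ T} => (i : Fin n))
  have hker : LinearMap.ker B'.mulVecLin = ⊥ := by
    rw [LinearMap.ker_eq_bot']
    intro w hw
    let v : Fin n → K := fun i => if hi : i ∈ T then w ⟨i, hi⟩ else 0
    have hv : B *ᵥ v = 0 := by
      rw [← hw]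
      funext y
      have h1 : ∑ i, B y i * v i = ∑ i ∈ T, B y i * v i :=
        (Finset.sum_subset (Finset.subset_univ T) fun i _ hi => by simp [v, hi]).symm
      have h2 : ∑ i ∈ T, B y i * v i = ∑ i : {i // i ∈ T}, B y i * v i :=
        (Finset.sum_coe_sort T fun i => B y i * v i).symm
      refine (h1.trans h2).trans (Finset.sum_congr rfl fun i _ => ?_)
      simp [v, B']
    have h0 := h v (fun i hi => by simp [v, hi]) hv
    funext i
    have := congrFun h0 i
    simpa [v] using this
  have h1 := LinearMap.finrank_range_add_finrank_ker B'.mulVecLin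
  rw [hker, finrank_bot, add_zero, Module.finrank_fintype_fun_eq_card, Fintype.card_coe] at h1
  calc T.card = B'.rank := h1.symm
    _ ≤ B.rank := Matrix.rank_submatrix_le _ _ _

/-- If no nonzero mode is unobservable, then `A` is nilpotent on the unobservable subspace. -/
theorem pow_mulVec_eq_zero_of_mem_unobs {K m : Type} [Field K] [IsAlgClosed K] {n : ℕ}
    {A : Matrix (Fin n) (Fin n) K} {C : Matrix m (Fin n) K}
    (h : ∀ μ : K, μ ≠ 0 → ∀ v, A *ᵥ v = μ • v → C *ᵥ v = 0 → v = 0) {v : Fin n → K}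
    (hv : v ∈ unobs A C) : A ^ n *ᵥ v = 0 := by
  let f : Module.End K (Fin n → K) := A.mulVecLin
  have hinf := Submodule.inf_iSup_genEigenspace (f := f) (p := unobs A C)
    (fun x hx => mulVec_mem_unobs hx) ⊤
  have htop : ⨆ μ, f.genEigenspace μ ⊤ = ⊤ := Module.End.iSup_maxGenEigenspace_eq_top f
  rw [htop, inf_top_eq] at hinf
  -- One factor `f - μ` is peeled off at a time: the last nonzero vector would be an unobservable
  -- eigenvector.
  have key : ∀ μ : K, μ ≠ 0 → ∀ (k : ℕ) (w : Fin n → K), w ∈ unobs A C →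
      ((f - μ • (1 : Module.End K (Fin n → K))) ^ k) w = 0 → w = 0 := by
    intro μ hμ k
    induction k with
    | zero => exact fun w _ hw => hw
    | succ k ih =>
      intro w hw h0
      rw [pow_succ, Module.End.mul_apply] at h0
      have h1 := ih _ (Submodule.sub_mem _ (mulVec_mem_unobs hw) (Submodule.smul_mem _ μ hw)) h0
      refine h μ hμ w (sub_eq_zero.1 h1) (mulVec_eq_zero_of_mem_unobs hw)
  have hle : unobs A C ≤ Module.End.maxGenEigenspace f 0 := by
    rw [hinf]
    refine iSup_le fun μ w hw => ?_
    by_cases hμ : μ = 0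
    · rw [← hμ]
      exact hw.2
    · obtain ⟨k, hk⟩ := (Module.End.mem_maxGenEigenspace f μ w).1 hw.2
      rw [key μ hμ k w hw.1 hk]
      exact Submodule.zero_mem _
  have h1 := hle hv
  rw [Module.End.maxGenEigenspace_eq_genEigenspace_finrank, Module.End.genEigenspace_nat,
    zero_smul, sub_zero, Module.finrank_fin_fun, LinearMap.mem_ker] at h1
  have h2 : f ^ n = (A ^ n).mulVecLin := by
    rw [← Matrix.toLin'_apply', Matrix.toLin'_pow]
    rfl
  rwa [h2] at h1

/-- Outputs not hit by `f` are fixed, so every output is already in the image, and the remaining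
outputs can only be sent to states. -/
theorem exists_perm_extending {α β : Type} [Fintype α] [Fintype β] (f : α → α ⊕ β)
    (hf : Function.Injective f) :
    ∃ τ : Equiv.Perm (α ⊕ β), (∀ i, τ (Sum.inl i) = f i) ∧
      ∀ y, (∃ i, τ (Sum.inr y) = Sum.inl i) ∨ τ (Sum.inr y) = Sum.inr y := by
  classical
  let s : Finset (α ⊕ β) := Finset.univ.filter fun v => ∀ y, v = Sum.inr y → ∀ i, f i ≠ Sum.inr y
  let g : α ⊕ β → α ⊕ β := Sum.elim f Sum.inr
  have hinj : Set.InjOn g s := by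
    rintro (i | y) hi (j | z) hj hij
    · exact congrArg _ (hf hij)
    · exact absurd hij ((Finset.mem_filter.1 hj).2 z rfl i)
    · exact absurd hij.symm ((Finset.mem_filter.1 hi).2 y rfl j)
    · exact hij
  obtain ⟨e, he⟩ := Finset.exists_equiv_extend_of_card_eq (t := (Finset.univ : Finset (α ⊕ β)))
    (by rw [Finset.card_univ]) (s := s) (f := g) (Finset.subset_univ _) hinj
  let τ : Equiv.Perm (α ⊕ β) := e.trans (Equiv.subtypeUnivEquiv Finset.mem_univ)
  have hl : ∀ i, Sum.inl i ∈ s := fun i => Finset.mem_filter.2 ⟨Finset.mem_univ _, by simp⟩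
  have hτ : ∀ v ∈ s, τ v = g v := fun v hv => he v hv
  refine ⟨τ, fun i => hτ _ (hl i), fun y => ?_⟩
  by_cases hy : Sum.inr y ∈ s
  · exact Or.inr (hτ _ hy)
  · left
    rcases h : τ (Sum.inr y) with i | z
    · exact ⟨i, rfl⟩
    · exfalso
      have hz : ∃ v ∈ s, g v = Sum.inr z := by
        by_cases hz : Sum.inr z ∈ s
        · exact ⟨_, hz, rfl⟩
        · have : ∃ i, f i = Sum.inr z := by
            by_contra! h0
            exact hz (Finset.mem_filter.2 ⟨Finset.mem_univ _, fun y' hy' i => by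
              rw [← Sum.inr_injective hy']
              exact h0 i⟩)
          obtain ⟨i, hi⟩ := this
          exact ⟨_, hl i, hi⟩
      obtain ⟨v, hv, hgv⟩ := hz
      rw [← hgv, ← hτ v hv] at h
      exact hy (τ.injective h ▸ hv)

/-- A linking can be closed up by an output injection to a matrix of disjoint cycles. -/
theorem exists_gain_linkSize_le {n : ℕ} {m : Type} [Fintype m] {A : StructMat (Fin n) (Fin n)}
    {C : StructMat m (Fin n)} {f : Fin n → Fin n ⊕ m}
    (hf : IsLinking (fun v i => Matrix.fromRows A C v i = true) f) :
    ∃ (G : Matrix (Fin n) m ℝ) (M : Matrix (Fin n) (Fin n) ℝ) (N : Matrix m (Fin n) ℝ),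
      Fits A M ∧ Fits C N ∧
        linkSize (fun v i => Matrix.fromRows A C v i = true) f ≤ ((M + G * N) ^ n).rank := by
  classical
  obtain ⟨τ, hτ, hτ'⟩ := exists_perm_extending f hf.1
  let act : Fin n → Prop := fun i => Matrix.fromRows A C (f i) i = true
  -- `π` closes the linking up: a state linked to an output `y` continues along `τ` from `y` to a
  -- state. Injectivity of `τ` prevents `y` from being fixed.
  have hπ : ∀ i, ∃ j, f i = Sum.inl j ∨ ∃ y, f i = Sum.inr y ∧ τ (Sum.inr y) = Sum.inl j := by
    intro i
    rcases h : f i with j | y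
    · exact ⟨j, Or.inl rfl⟩
    · rcases hτ' y with ⟨j, hj⟩ | hy
      · exact ⟨j, Or.inr ⟨y, rfl, hj⟩⟩
      · have h1 : τ (Sum.inl i) = τ (Sum.inr y) := by rw [hτ, h, hy]
        exact absurd (τ.injective h1) (by simp)
  choose π hπ using hπ
  have hπi : Function.Injective π := by
    intro i j hij
    rcases hπ i with hi | ⟨y, hi, hy⟩ <;> rcases hπ j with hj | ⟨z, hj, hz⟩
    · exact hf.1 (by rw [hi, hj, hij])
    · have : τ (Sum.inl i) = τ (Sum.inr z) := by rw [hτ, hi, hz, hij]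
      exact absurd (τ.injective this) (by simp)
    · have : τ (Sum.inl j) = τ (Sum.inr y) := by rw [hτ, hj, hy, hij]
      exact absurd (τ.injective this) (by simp)
    · have : τ (Sum.inr y) = τ (Sum.inr z) := by rw [hy, hz, hij]
      exact hf.1 (by rw [hi, hj, Sum.inr_injective (τ.injective this)])
  let M : Matrix (Fin n) (Fin n) ℝ := fun j i => if f i = Sum.inl j ∧ act i then 1 else 0
  let N : Matrix m (Fin n) ℝ := fun y i => if f i = Sum.inr y ∧ act i then 1 else 0
  let G : Matrix (Fin n) m ℝ := fun j y => if τ (Sum.inr y) = Sum.inl j then 1 else 0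
  have hMN : ∀ j i, (M + G * N) j i = if act i ∧ π i = j then 1 else 0 := by
    intro j i
    rw [Matrix.add_apply, Matrix.mul_apply]
    rcases hπ i with hi | ⟨y, hi, hy⟩
    · simp [M, N, hi, and_comm]
    · by_cases ha : act i <;> simp [M, N, G, hi, hy, ha]
  have hact : ∀ i, act (π i) → act i := by
    intro i hi
    by_contra h
    have h1 := (hf.2 i).resolve_left h
    rcases hπ i with h2 | ⟨y, h2, -⟩
    · rw [h1] at h2
      rw [← Sum.inl_injective h2] at hi
      exact h hi
    · rw [h1] at h2
      simp at h2
  have hfix : ∀ i, ¬ act i → π i = i := by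
    intro i hi
    have h1 := (hf.2 i).resolve_left hi
    rcases hπ i with h2 | ⟨y, h2, -⟩
    · exact (Sum.inl_injective (h1.symm.trans h2)).symm
    · simp [h1] at h2
  have hinact : ∀ (v : Fin n → ℝ) j, ¬ act j → ((M + G * N) *ᵥ v) j = 0 := by
    intro v j hj
    rw [Matrix.mulVec, dotProduct]
    refine Finset.sum_eq_zero fun i _ => ?_
    rw [hMN]
    split_ifs with h
    · obtain ⟨hi, rfl⟩ := h
      have h2 := hπi (hfix _ hj)
      rw [h2] at hj
      exact absurd hi hj
    · rw [zero_mul]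
  have hmul : ∀ (v : Fin n → ℝ) i, act i → ((M + G * N) *ᵥ v) (π i) = v i := by
    intro v i hi
    rw [Matrix.mulVec, dotProduct, Finset.sum_eq_single i]
    · rw [hMN, if_pos ⟨hi, rfl⟩, one_mul]
    · intro j _ hj
      rw [hMN, if_neg fun h => hj (hπi h.2), zero_mul]
    · simp
  refine ⟨G, M, N, fun j i h => ?_, fun y i h => ?_, ?_⟩
  · have h1 : f i = Sum.inl j ∧ act i := by
      by_contra h'
      exact h (if_neg h')
    have h2 := h1.2
    simp only [act, h1.1] at h2
    exact h2
  · have h1 : f i = Sum.inr y ∧ act i := by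
      by_contra h'
      exact h (if_neg h')
    have h2 := h1.2
    simp only [act, h1.1] at h2
    exact h2
  · unfold linkSize
    refine card_le_rank_of_injOn_support _ _ fun v hv h0 => ?_
    -- On vectors supported on the covered states, `M + G * N` merely permutes coordinates by `π`,
    -- so none of its powers has a kernel there.
    have key : ∀ (k : ℕ) (v : Fin n → ℝ), (∀ i, ¬ act i → v i = 0) →
        (M + G * N) ^ k *ᵥ v = 0 → v = 0 := by
      intro k
      induction k with
      | zero => intro v _ h; simpa using h
      | succ k ih =>
        intro v hv h
        rw [pow_succ, ← Matrix.mulVec_mulVec] at h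
        have h1 := ih _ (hinact v) h
        funext i
        by_cases hi : act i
        · rw [← hmul v i hi, h1]
          rfl
        · exact hv i hi
    exact key n v (fun i hi => hv i (by simp only [Finset.mem_filter, not_and]; exact fun _ => hi)) h0

/-! A realization without unobservable nonzero modes -/

/-- The state `x_j` reaches a state that is read by an output. -/
def Reaches {n : ℕ} {m : Type} (A : StructMat (Fin n) (Fin n)) (C : StructMat m (Fin n))
    (j : Fin n) : Prop := ∃ k y, StateReach A j k ∧ C y k = true

/-- For each cycle of `σ` (including the fixed points) an edge by which to leave it, such that
the cycles become the nodes of a forest: `R` holds on the cycles that reach an output, `L` is the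
depth, and the cycle of `x` is left from the state `ez x` to `next x`. -/
structure ExitForest {n : ℕ} {m : Type} (A : StructMat (Fin n) (Fin n)) (C : StructMat m (Fin n))
    (σ : Equiv.Perm (Fin n)) where
  R : Fin n → Prop
  L : Fin n → ℕ
  ez : Fin n → Fin n
  next : Fin n → Fin n ⊕ m
  L_eq : ∀ x z, σ.SameCycle x z → L x = L z
  ez_eq : ∀ x z, σ.SameCycle x z → ez x = ez z
  next_eq : ∀ x z, σ.SameCycle x z → next x = next z
  sameCycle_ez : ∀ x, σ.SameCycle x (ez x)
  edge : ∀ x, R x → Matrix.fromRows A C (next x) (ez x) = true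
  R_next : ∀ x z, R x → next x = Sum.inl z → R z
  L_next : ∀ x z, R x → next x = Sum.inl z → L x = L z + 1
  L_out : ∀ x y, R x → next x = Sum.inr y → L x = 0
  R_of_reaches : ∀ x, Reaches A C x → R x

/-- The cycle of `x` reaches an output through `k` edges between cycles. -/
def CycleDist {n : ℕ} {m : Type} (A : StructMat (Fin n) (Fin n)) (C : StructMat m (Fin n))
    (σ : Equiv.Perm (Fin n)) : ℕ → Fin n → Prop
  | 0, x => ∃ z y, σ.SameCycle x z ∧ C y z = true
  | k + 1, x => ∃ z x', σ.SameCycle x z ∧ A x' z = true ∧ CycleDist A C σ k x'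

/-- Breadth-first search with the cycles as nodes: `L` is the least number of edges between cycles
needed to get to one that is read by an output. The first edge of a shortest route lowers `L` by
exactly one. -/
theorem nonempty_exitForest {n : ℕ} {m : Type} (A : StructMat (Fin n) (Fin n))
    (C : StructMat m (Fin n)) (σ : Equiv.Perm (Fin n)) : Nonempty (ExitForest A C σ) := by
  classical
  have hD : ∀ k x z, σ.SameCycle x z → CycleDist A C σ k z → CycleDist A C σ k x := by
    rintro (_ | k) x z h
    · rintro ⟨w, y, hw, hy⟩
      exact ⟨w, y, h.trans hw, hy⟩
    · rintro ⟨w, x', hw, hA, hx'⟩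
      exact ⟨w, x', h.trans hw, hA, hx'⟩
  let R : Fin n → Prop := fun x => ∃ k, CycleDist A C σ k x
  let L : Fin n → ℕ := fun x => sInf {k | CycleDist A C σ k x}
  have hL : ∀ x z, σ.SameCycle x z → L x = L z := fun x z h => by
    have : {k | CycleDist A C σ k x} = {k | CycleDist A C σ k z} :=
      Set.ext fun k => ⟨hD k z x h.symm, hD k x z h⟩
    simp only [L, this]
  have hex : ∀ x, ∃ (z : Fin n) (t : Fin n ⊕ m), σ.SameCycle x z ∧ (R x →
      Matrix.fromRows A C t z = true ∧ (∀ x', t = Sum.inl x' → R x' ∧ L x = L x' + 1) ∧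
        ∀ y, t = Sum.inr y → L x = 0) := by
    intro x
    by_cases hx : R x
    · have hmem : CycleDist A C σ (L x) x := Nat.sInf_mem hx
      rcases hLx : L x with _ | k
      · rw [hLx] at hmem
        obtain ⟨z, y, hz, hy⟩ := hmem
        exact ⟨z, Sum.inr y, hz, fun _ => ⟨hy, fun x' h => by simp at h, fun _ _ => rfl⟩⟩
      · rw [hLx] at hmem
        obtain ⟨z, x', hz, hA, hx'⟩ := hmem
        refine ⟨z, Sum.inl x', hz, fun _ => ⟨hA, fun x'' h => ?_, fun y h => by simp at h⟩⟩
        obtain rfl := Sum.inl_injective h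
        have h1 : L x' ≤ k := Nat.sInf_le hx'
        have h2 : CycleDist A C σ (L x') x' := Nat.sInf_mem (s := {k | CycleDist A C σ k x'}) ⟨k, hx'⟩
        have h3 : L x ≤ L x' + 1 := Nat.sInf_le ⟨z, x', hz, hA, h2⟩
        exact ⟨⟨k, hx'⟩, by omega⟩
    · exact ⟨x, Sum.inl x, Equiv.Perm.SameCycle.refl σ x, fun h => absurd h hx⟩
  choose z₀ t₀ hz ht using hex
  -- The exits were chosen state by state; evaluating them at one representative per cycle makes
  -- them constant on cycles.
  let q := Equiv.Perm.SameCycle.setoid σ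
  let rep : Fin n → Fin n := fun x => (Quotient.mk q x).out
  have hrep : ∀ x, σ.SameCycle x (rep x) := fun x =>
    (Quotient.exact (Quotient.out_eq (Quotient.mk q x))).symm
  have hrepeq : ∀ x z, σ.SameCycle x z → rep x = rep z := fun x z h => by
    have : Quotient.mk q x = Quotient.mk q z := Quotient.sound h
    simp only [rep, this]
  have hRrep : ∀ x, R x → R (rep x) := fun x ⟨k, hk⟩ => ⟨k, hD k _ _ (hrep x).symm hk⟩
  exact ⟨{
    R := R
    L := L
    ez := fun x => z₀ (rep x)
    next := fun x => t₀ (rep x)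
    L_eq := hL
    ez_eq := fun x z h => by rw [hrepeq x z h]
    next_eq := fun x z h => by rw [hrepeq x z h]
    sameCycle_ez := fun x => (hrep x).trans (hz _)
    edge := fun x hx => (ht _ (hRrep x hx)).1
    R_next := fun x z hx h => ((ht _ (hRrep x hx)).2.1 z h).1
    L_next := fun x z hx h => by
      rw [hL x _ (hrep x)]
      exact ((ht _ (hRrep x hx)).2.1 z h).2
    L_out := fun x y hx h => by
      rw [hL x _ (hrep x)]
      exact (ht _ (hRrep x hx)).2.2 y h
    R_of_reaches := by
      rintro x ⟨k, y, hxk, hy⟩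
      induction hxk using Relation.ReflTransGen.head_induction_on with
      | refl => exact ⟨0, k, y, Equiv.Perm.SameCycle.refl σ k, hy⟩
      | head hab _ ih =>
        obtain ⟨d, hd⟩ := ih
        exact ⟨d + 1, _, _, Equiv.Perm.SameCycle.refl σ _, hab, hd⟩ }⟩

/-- Distinct positive weights separate the moduli of the eigenvalues belonging to different cycles.
-/
theorem exists_cycleWeight {n : ℕ} (σ : Equiv.Perm (Fin n)) :
    ∃ c : Fin n → ℝ, (∀ x, 0 < c x) ∧ ∀ x z, c x = c z ↔ σ.SameCycle x z := by
  classical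
  let q := Equiv.Perm.SameCycle.setoid σ
  refine ⟨fun x => (((Quotient.mk q x).out : Fin n) : ℕ) + 1, fun x => by positivity,
    fun x z => ?_⟩
  rw [add_left_inj, Nat.cast_inj, Fin.val_inj, Quotient.out_inj]
  exact ⟨fun h => Quotient.exact h, fun h => Quotient.sound h⟩

section forest
variable {n : ℕ} {m : Type} {A : StructMat (Fin n) (Fin n)} {C : StructMat m (Fin n)}
  {σ : Equiv.Perm (Fin n)}

open Classical in
/-- The state matrix with weight `c` on the edges of the cycles and weight `1` on the exits. -/
def forestA (A : StructMat (Fin n) (Fin n)) (T : ExitForest A C σ) (c : Fin n → ℝ) :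
    Matrix (Fin n) (Fin n) ℂ := fun j i =>
  (if A (σ i) i = true ∧ σ i = j then (c i : ℂ) else 0) +
    if T.R i ∧ T.ez i = i ∧ T.next i = Sum.inl j then 1 else 0

open Classical in
/-- The output matrix that reads the exits to outputs. -/
def forestC (T : ExitForest A C σ) : Matrix m (Fin n) ℂ := fun y i =>
  if T.R i ∧ T.ez i = i ∧ T.next i = Sum.inr y then 1 else 0

theorem fits_forestA (T : ExitForest A C σ) (c : Fin n → ℝ) : Fits A (forestA A T c) := by
  classical
  intro j i h
  by_contra h'
  refine h ?_
  unfold forestA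
  rw [if_neg, if_neg, add_zero]
  · rintro ⟨h1, h2, h3⟩
    have := T.edge i h1
    rw [h2, h3] at this
    exact h' this
  · rintro ⟨h1, rfl⟩
    exact h' h1

theorem fits_forestC (T : ExitForest A C σ) : Fits C (forestC T) := by
  classical
  intro y i h
  by_contra h'
  refine h ?_
  unfold forestC
  rw [if_neg]
  rintro ⟨h1, h2, h3⟩
  have := T.edge i h1
  rw [h2, h3] at this
  exact h' this

open Classical in
theorem forestA_mulVec (T : ExitForest A C σ) (c : Fin n → ℝ) (v : Fin n → ℂ) (j : Fin n) :
    (forestA A T c *ᵥ v) j =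
      (if A j (σ.symm j) = true then (c (σ.symm j) : ℂ) * v (σ.symm j) else 0) +
        ∑ i, if T.R i ∧ T.ez i = i ∧ T.next i = Sum.inl j then v i else 0 := by
  rw [Matrix.mulVec, dotProduct]
  simp only [forestA, add_mul, Finset.sum_add_distrib, ite_mul, one_mul, zero_mul]
  congr 1
  rw [Finset.sum_eq_single (σ.symm j)]
  · simp
  · intro i _ hi
    rw [if_neg]
    rintro ⟨-, rfl⟩
    simp at hi
  · simp

/-- Without inflow from other cycles, `A` acts as the weighted cycle. -/
theorem forestA_mulVec_of_inflow_eq_zero (T : ExitForest A C σ) (c : Fin n → ℝ) (v : Fin n → ℂ)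
    (j : Fin n) (h : ∀ i, T.R i → T.ez i = i → T.next i = Sum.inl j → v i = 0) :
    (forestA A T c *ᵥ v) j =
      if A j (σ.symm j) = true then (c (σ.symm j) : ℂ) * v (σ.symm j) else 0 := by
  classical
  rw [forestA_mulVec, Finset.sum_eq_zero, add_zero]
  intro i _
  split_ifs with hi
  · exact h i hi.1 hi.2.1 hi.2.2
  · rfl

/-- A nontrivial cycle of `σ` consists of edges; only a fixed point can lack its loop. -/
theorem act_iff_of_sameCycle (hσ : ∀ i, A (σ i) i = true ∨ σ i = i) {x z : Fin n}
    (h : σ.SameCycle x z) : A (σ x) x = true ↔ A (σ z) z = true := by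
  by_cases hx : σ x = x
  · rw [h.eq_of_left hx]
  · have hz : σ z ≠ z := fun hz => hx (h.apply_eq_self_iff.2 hz)
    exact ⟨fun _ => (hσ z).resolve_right hz, fun _ => (hσ x).resolve_right hx⟩

/-- The powers of `A` do not annihilate vectors on the states of the cycles. -/
theorem forestA_pow_ne_zero (hσ : ∀ i, A (σ i) i = true ∨ σ i = i) (T : ExitForest A C σ)
    {c : Fin n → ℝ} (hc : ∀ x, 0 < c x) (hc' : ∀ x z, c x = c z ↔ σ.SameCycle x z)
    {v : Fin n → ℂ} (hv : ∀ i, ¬ A (σ i) i = true → v i = 0) (k : ℕ)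
    (h0 : forestA A T c ^ k *ᵥ v = 0) : v = 0 := by
  classical
  by_contra hne
  obtain ⟨x₁, hx₁⟩ := Function.ne_iff.1 hne
  obtain ⟨x₀, hx₀, hmax⟩ := Finset.exists_max_image (Finset.univ.filter fun x => v x ≠ 0) T.L
    ⟨x₁, Finset.mem_filter.2 ⟨Finset.mem_univ _, hx₁⟩⟩
  have hvx₀ : v x₀ ≠ 0 := (Finset.mem_filter.1 hx₀).2
  have hact : A (σ x₀) x₀ = true := by
    by_contra h
    exact hvx₀ (hv _ h)
  -- Exits lower the depth, so the cycle of `x₀`, of maximal depth in the support, receives nothing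
  -- from outside: there `A` rotates the entries and multiplies them by the weight.
  have key : ∀ k : ℕ, (∀ j, T.L x₀ < T.L j → (forestA A T c ^ k *ᵥ v) j = 0) ∧
      (forestA A T c ^ k *ᵥ v) ((σ ^ k) x₀) = (c x₀ : ℂ) ^ k * v x₀ := by
    intro k
    induction k with
    | zero =>
      refine ⟨fun j hj => ?_, by simp⟩
      by_contra h
      have h1 := hmax j (Finset.mem_filter.2 ⟨Finset.mem_univ _, by simpa using h⟩)
      omega
    | succ k ih =>
      have hz : ∀ j, T.L x₀ ≤ T.L j → ∀ i, T.R i → T.ez i = i → T.next i = Sum.inl j →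
          (forestA A T c ^ k *ᵥ v) i = 0 := by
        intro j hj i hR _ hi
        have := T.L_next i j hR hi
        exact ih.1 i (by omega)
      rw [pow_succ', ← Matrix.mulVec_mulVec]
      constructor
      · intro j hj
        rw [forestA_mulVec_of_inflow_eq_zero T c _ j (hz j hj.le)]
        have h1 : T.L (σ.symm j) = T.L j := T.L_eq _ _ (by
          rw [Equiv.Perm.sameCycle_symm_apply_left])
        rw [ih.1 (σ.symm j) (by omega), mul_zero, ite_self]
      · have hs : σ.SameCycle x₀ ((σ ^ k) x₀) := by
          rw [Equiv.Perm.sameCycle_pow_right]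
        have hs' : σ.SameCycle x₀ ((σ ^ (k + 1)) x₀) := by
          rw [Equiv.Perm.sameCycle_pow_right]
        rw [forestA_mulVec_of_inflow_eq_zero T c _ _ (hz _ (T.L_eq _ _ hs').le)]
        have h1 : σ.symm ((σ ^ (k + 1)) x₀) = (σ ^ k) x₀ := by
          rw [pow_succ', Equiv.Perm.mul_apply, Equiv.symm_apply_apply]
        have h2 : A ((σ ^ (k + 1)) x₀) ((σ ^ k) x₀) = true := by
          rw [pow_succ', Equiv.Perm.mul_apply]
          exact (act_iff_of_sameCycle hσ hs).1 hact
        rw [h1, if_pos h2, ih.2, ← (hc' _ _).2 hs]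
        ring
  have h1 := (key k).2
  rw [h0] at h1
  have h2 : (c x₀ : ℂ) ≠ 0 := by exact_mod_cast (hc x₀).ne'
  exact mul_ne_zero (pow_ne_zero k h2) hvx₀ h1.symm

/-- On a cycle without inflow, eigenvectors belong to eigenvalues whose modulus is the weight. -/
theorem norm_eq_of_no_inflow (hσ : ∀ i, A (σ i) i = true ∨ σ i = i) (T : ExitForest A C σ)
    {c : Fin n → ℝ} (hc : ∀ x, 0 < c x) (hc' : ∀ x z, c x = c z ↔ σ.SameCycle x z)
    {v : Fin n → ℂ} {μ : ℂ} (hμ : μ ≠ 0) (hv : forestA A T c *ᵥ v = μ • v) {x : Fin n}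
    (hx : v x ≠ 0) (hin : ∀ j, σ.SameCycle x j → ∀ i, T.R i → T.ez i = i →
      T.next i = Sum.inl j → v i = 0) :
    c x = ‖μ‖ ∧ ∀ z, σ.SameCycle x z → v z ≠ 0 := by
  have hstep : ∀ j, σ.SameCycle x j →
      μ * v j = if A j (σ.symm j) = true then (c (σ.symm j) : ℂ) * v (σ.symm j) else 0 := by
    intro j hj
    rw [← forestA_mulVec_of_inflow_eq_zero T c v j (hin j hj), hv]
    rfl
  have hact : A (σ x) x = true := by
    by_contra h
    have h1 : σ x = x := (hσ x).resolve_left h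
    have h2 : σ.symm x = x := by rw [Equiv.symm_apply_eq, h1]
    have h3 := hstep x (Equiv.Perm.SameCycle.refl σ x)
    rw [h1] at h
    rw [h2, if_neg h] at h3
    exact mul_ne_zero hμ hx h3
  have key : ∀ k : ℕ, μ ^ k * v ((σ ^ k) x) = (c x : ℂ) ^ k * v x := by
    intro k
    induction k with
    | zero => simp
    | succ k ih =>
      have hs : σ.SameCycle x ((σ ^ k) x) := by rw [Equiv.Perm.sameCycle_pow_right]
      have h1 := hstep ((σ ^ (k + 1)) x) (by rw [Equiv.Perm.sameCycle_pow_right])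
      have h2 : σ.symm ((σ ^ (k + 1)) x) = (σ ^ k) x := by
        rw [pow_succ', Equiv.Perm.mul_apply, Equiv.symm_apply_apply]
      have h3 : A ((σ ^ (k + 1)) x) ((σ ^ k) x) = true := by
        rw [pow_succ', Equiv.Perm.mul_apply]
        exact (act_iff_of_sameCycle hσ hs).1 hact
      rw [h2, if_pos h3, ← (hc' _ _).2 hs] at h1
      calc μ ^ (k + 1) * v ((σ ^ (k + 1)) x) = μ ^ k * (μ * v ((σ ^ (k + 1)) x)) := by ring
        _ = c x * (μ ^ k * v ((σ ^ k) x)) := by rw [h1]; ring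
        _ = _ := by rw [ih]; ring
  have hcx : (c x : ℂ) ≠ 0 := by exact_mod_cast (hc x).ne'
  constructor
  -- After `orderOf σ` steps the cycle is back at `x`, so `μ` and `c x` have equal powers and hence
  -- equal moduli.
  · have h1 := key (orderOf σ)
    rw [pow_orderOf_eq_one, Equiv.Perm.one_apply] at h1
    have h2 := congrArg norm (mul_right_cancel₀ hx h1)
    rw [norm_pow, norm_pow, Complex.norm_real, Real.norm_of_nonneg (hc x).le] at h2
    exact (pow_left_inj₀ (hc x).le (norm_nonneg μ) (orderOf_pos σ).ne').1 h2.symm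
  · intro z hz
    obtain ⟨k, rfl⟩ := hz.exists_nat_pow_eq
    intro h0
    have h1 := key k
    rw [h0, mul_zero] at h1
    exact mul_ne_zero (pow_ne_zero k hcx) hx h1.symm

/-- Every mode with a nonzero eigenvalue is observable. -/
theorem eq_zero_of_unobservable_mode (hσ : ∀ i, A (σ i) i = true ∨ σ i = i)
    (hreach : ∀ j i, A j i = true → Reaches A C j) (T : ExitForest A C σ)
    {c : Fin n → ℝ} (hc : ∀ x, 0 < c x) (hc' : ∀ x z, c x = c z ↔ σ.SameCycle x z)
    {v : Fin n → ℂ} {μ : ℂ} (hμ : μ ≠ 0) (hv : forestA A T c *ᵥ v = μ • v)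
    (hC : forestC T *ᵥ v = 0) : v = 0 := by
  classical
  by_contra hne
  obtain ⟨x₁, hx₁⟩ := Function.ne_iff.1 hne
  obtain ⟨x₀, hx₀, hmax⟩ := Finset.exists_max_image (Finset.univ.filter fun x => v x ≠ 0) T.L
    ⟨x₁, Finset.mem_filter.2 ⟨Finset.mem_univ _, hx₁⟩⟩
  have hvx₀ : v x₀ ≠ 0 := (Finset.mem_filter.1 hx₀).2
  have hle : ∀ i, v i ≠ 0 → T.L i ≤ T.L x₀ := fun i hi =>
    hmax i (Finset.mem_filter.2 ⟨Finset.mem_univ _, hi⟩)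
  have hR : ∀ x, v x ≠ 0 → T.R x := by
    intro x hx
    by_contra h
    have h1 : (forestA A T c *ᵥ v) x = 0 := by
      rw [Matrix.mulVec, dotProduct]
      refine Finset.sum_eq_zero fun i _ => ?_
      by_contra h0
      exact h (T.R_of_reaches x (hreach x i (fits_forestA T c x i (left_ne_zero_of_mul h0))))
    rw [hv] at h1
    exact mul_ne_zero hμ hx h1
  have htop : ∀ x, v x ≠ 0 → T.L x = T.L x₀ → ∀ j, σ.SameCycle x j → ∀ i, T.R i → T.ez i = i →
      T.next i = Sum.inl j → v i = 0 := by
    intro x _ hL j hj i hi _ hij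
    by_contra h0
    have h1 := hle i h0
    have h2 := T.L_next i j hi hij
    have h3 := T.L_eq x j hj
    omega
  obtain ⟨hcx₀, hnz₀⟩ := norm_eq_of_no_inflow hσ T hc hc' hμ hv hvx₀ (htop x₀ hvx₀ rfl)
  -- Descending from the maximal depth to `0`, the mode lives at each depth `k` on exactly one cycle
  -- and is nonzero on all of that cycle.
  have chain : ∀ d k, k + d = T.L x₀ → ∃ x, T.R x ∧ T.L x = k ∧ (∀ z, σ.SameCycle x z → v z ≠ 0) ∧
      ∀ z, T.L z = k → v z ≠ 0 → σ.SameCycle x z := by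
    intro d
    induction d with
    | zero =>
      intro k hk
      refine ⟨x₀, hR _ hvx₀, by omega, hnz₀, fun z hz hvz => ?_⟩
      rw [← hc', hcx₀]
      exact (norm_eq_of_no_inflow hσ T hc hc' hμ hv hvz (htop z hvz (by omega))).1.symm
    | succ d ih =>
      intro k hk
      obtain ⟨x, hRx, hLx, hnz, huniq⟩ := ih (k + 1) (by omega)
      rcases hx' : T.next x with x' | y
      swap
      · have := T.L_out x y hRx hx'
        omega
      have hLx' : T.L x' = k := by
        have := T.L_next x x' hRx hx'
        omega
      have hvz : v (T.ez x) ≠ 0 := hnz _ (T.sameCycle_ez x)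
      have hinflow : ∀ j, T.L j = k → ∀ i, T.R i → T.ez i = i → T.next i = Sum.inl j → v i ≠ 0 →
          i = T.ez x ∧ j = x' := by
        intro j hj i hi hez hij h0
        have h1 : T.L i = k + 1 := by rw [T.L_next i j hi hij, hj]
        have h2 := huniq i h1 h0
        refine ⟨by rw [T.ez_eq x i h2, hez], ?_⟩
        rw [← T.next_eq x i h2, hx'] at hij
        exact (Sum.inl_injective hij).symm
      -- Only the cycle of `x'` receives inflow at depth `k`. Any other cycle in the support would
      -- have weight `‖μ‖`, hence be the cycle of `x₀`, which lies at a greater depth.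
      have hu : ∀ z, T.L z = k → v z ≠ 0 → σ.SameCycle x' z := by
        intro z hz hvz'
        by_contra hnot
        have h1 := norm_eq_of_no_inflow hσ T hc hc' hμ hv hvz' fun j hj i hi hez hij => by
          by_contra h0
          have h2 := hinflow j (by rw [← T.L_eq z j hj, hz]) i hi hez hij h0
          exact hnot (h2.2 ▸ hj.symm)
        have h3 : σ.SameCycle x₀ z := by rw [← hc', hcx₀, h1.1]
        have h4 := T.L_eq x₀ z h3
        omega
      have hcyc : ∀ j, T.L j = k → j ≠ x' → μ * v j =
          if A j (σ.symm j) = true then (c (σ.symm j) : ℂ) * v (σ.symm j) else 0 := by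
        intro j hj hne'
        rw [← forestA_mulVec_of_inflow_eq_zero T c v j, hv]
        · rfl
        · intro i hi hez hij
          by_contra h0
          exact hne' (hinflow j hj i hi hez hij h0).2
      have hLpow : ∀ k' : ℕ, T.L ((σ ^ k') x') = k := fun k' => by
        rw [← hLx']
        exact (T.L_eq _ _ (by rw [Equiv.Perm.sameCycle_pow_right])).symm
      have hsymm : ∀ k' : ℕ, σ.symm ((σ ^ (k' + 1)) x') = (σ ^ k') x' := fun k' => by
        rw [pow_succ', Equiv.Perm.mul_apply, Equiv.symm_apply_apply]
      -- If `v x' = 0`, then `v` vanishes all around this cycle, and the equation at `x'` reduces to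
      -- `0 = v (T.ez x)`, contradicting the depth above.
      have hvx' : v x' ≠ 0 := by
        intro h0
        have hz : ∀ k' : ℕ, v ((σ ^ k') x') = 0 := by
          intro k'
          induction k' with
          | zero => simpa using h0
          | succ k' ih' =>
            by_cases hfix : (σ ^ (k' + 1)) x' = x'
            · rw [hfix, h0]
            · have h1 := hcyc _ (hLpow (k' + 1)) hfix
              rw [hsymm, ih', mul_zero, ite_self] at h1
              exact (mul_eq_zero.1 h1).resolve_left hμ
        have hs : σ.SameCycle x' (σ.symm x') := by rw [Equiv.Perm.sameCycle_symm_apply_right]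
        obtain ⟨k', hk'⟩ := hs.exists_nat_pow_eq
        have h1 : (forestA A T c *ᵥ v) x' = v (T.ez x) := by
          rw [forestA_mulVec, ← hk', hz, mul_zero, ite_self, zero_add,
            Finset.sum_eq_single (T.ez x)]
          · have hsz := T.sameCycle_ez x
            rw [if_pos ⟨hR _ hvz, (T.ez_eq _ _ hsz).symm, (T.next_eq _ _ hsz).symm.trans hx'⟩]
          · intro i _ hi
            split_ifs with h
            · by_contra h0
              exact hi (hinflow x' hLx' i h.1 h.2.1 h.2.2 h0).1
            · rfl
          · simp
        rw [hv, Pi.smul_apply, h0, smul_zero] at h1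
        exact hvz h1.symm
      refine ⟨x', T.R_next x x' hRx hx', hLx', fun z hz => ?_, hu⟩
      obtain ⟨k', rfl⟩ := hz.exists_nat_pow_eq
      clear hz
      induction k' with
      | zero => simpa using hvx'
      | succ k' ih' =>
        by_cases hfix : (σ ^ (k' + 1)) x' = x'
        · rwa [hfix]
        · have h1 := hcyc _ (hLpow (k' + 1)) hfix
          have hne' : σ ((σ ^ k') x') ≠ (σ ^ k') x' := by
            intro h
            have hs : σ.SameCycle x' ((σ ^ k') x') := by rw [Equiv.Perm.sameCycle_pow_right]
            have h2 : x' = (σ ^ k') x' := hs.eq_of_right h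
            refine hfix ?_
            rw [pow_succ', Equiv.Perm.mul_apply, h, ← h2]
          have hact : A ((σ ^ (k' + 1)) x') ((σ ^ k') x') = true := by
            rw [pow_succ', Equiv.Perm.mul_apply]
            exact (hσ _).resolve_right hne'
          rw [hsymm, if_pos hact] at h1
          have hcz : (c ((σ ^ k') x') : ℂ) ≠ 0 := by exact_mod_cast (hc _).ne'
          exact fun h0 => mul_ne_zero hcz ih' (by rw [← h1, h0, mul_zero])
  -- At depth `0` the unique cycle exits to an output, and no other state in the support feeds that
  -- output, so nothing can cancel.
  obtain ⟨x, hRx, hLx, hnz, huniq⟩ := chain (T.L x₀) 0 (by omega)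
  rcases hx' : T.next x with x' | y
  · have := T.L_next x x' hRx hx'
    omega
  have hsz := T.sameCycle_ez x
  have hvz : v (T.ez x) ≠ 0 := hnz _ hsz
  have h1 : (forestC T *ᵥ v) y = v (T.ez x) := by
    rw [Matrix.mulVec, dotProduct, Finset.sum_eq_single (T.ez x)]
    · unfold forestC
      rw [if_pos ⟨hR _ hvz, (T.ez_eq _ _ hsz).symm, (T.next_eq _ _ hsz).symm.trans hx'⟩, one_mul]
    · intro i _ hi
      unfold forestC
      split_ifs with h
      · by_contra h0
        have h2 := huniq i (T.L_out i y h.1 h.2.2) (right_ne_zero_of_mul h0)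
        exact hi (by rw [T.ez_eq x i h2, h.2.1])
      · rw [zero_mul]
    · simp
  rw [hC] at h1
  exact hvz h1.symm

end forest

/-- Some complex realization has no unobservable modes with nonzero eigenvalues, in the form of a
rank condition. -/
theorem exists_card_le_rank_obsMat_mul_pow {n : ℕ} {m : Type} [Fintype m]
    {A : StructMat (Fin n) (Fin n)} {C : StructMat m (Fin n)} {σ : Equiv.Perm (Fin n)}
    (hσ : ∀ i, A (σ i) i = true ∨ σ i = i) (hreach : ∀ j i, A j i = true → Reaches A C j) :
    ∃ (M : Matrix (Fin n) (Fin n) ℂ) (N : Matrix m (Fin n) ℂ), Fits A M ∧ Fits C N ∧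
      (Finset.univ.filter fun i => A (σ i) i = true).card ≤ (obsMat M N * M ^ n).rank := by
  obtain ⟨T⟩ := nonempty_exitForest A C σ
  obtain ⟨c, hc, hc'⟩ := exists_cycleWeight σ
  refine ⟨forestA A T c, forestC T, fits_forestA T c, fits_forestC T,
    card_le_rank_of_injOn_support _ _ fun v hv h0 => ?_⟩
  rw [← Matrix.mulVec_mulVec] at h0
  have h1 : forestA A T c ^ n *ᵥ v ∈ unobs (forestA A T c) (forestC T) := by
    rw [← ker_obsMat]
    exact h0
  have h2 := pow_mulVec_eq_zero_of_mem_unobs (fun μ hμ w hw hw' =>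
    eq_zero_of_unobservable_mode hσ hreach T hc hc' hμ hw hw') h1
  rw [Matrix.mulVec_mulVec, ← pow_add] at h2
  exact forestA_pow_ne_zero hσ T hc hc' (fun i hi => hv i (by simpa using hi)) _ h2

/-! The generic rank of the observability matrix and linkings -/

/-- The edges from states to states that reach an output, and from states to outputs. -/
def obsEdge {n : ℕ} {m : Type} (A : StructMat (Fin n) (Fin n)) (C : StructMat m (Fin n)) :
    Fin n ⊕ m → Fin n → Prop
  | Sum.inl j, i => A j i = true ∧ Reaches A C j
  | Sum.inr y, i => C y i = true

theorem IsLinking.mono {n : ℕ} {m : Type} {E E' : Fin n ⊕ m → Fin n → Prop}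
    {f : Fin n → Fin n ⊕ m} (h : IsLinking E f) (hE : ∀ v i, E v i → E' v i) : IsLinking E' f :=
  ⟨h.1, fun i => (h.2 i).imp_left (hE _ _)⟩

theorem linkSize_mono {n : ℕ} {m m' : Type} {E : Fin n ⊕ m → Fin n → Prop}
    {E' : Fin n ⊕ m' → Fin n → Prop} {f : Fin n → Fin n ⊕ m} {f' : Fin n → Fin n ⊕ m'}
    (hE : ∀ i, E (f i) i → E' (f' i) i) : linkSize E f ≤ linkSize E' f' := by
  unfold linkSize
  refine Finset.card_le_card fun i hi => ?_
  simp only [Finset.mem_filter, Finset.mem_univ, true_and] at hi ⊢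
  exact hE i hi

section
variable {n : ℕ} {m : Type} [Fintype m] {A : StructMat (Fin n) (Fin n)} {C : StructMat m (Fin n)}

/-- The rank of a realization is at most the size of a linking. -/
theorem exists_obsEdge_linking_rank_le {K : Type} [Field K] {M : Matrix (Fin n) (Fin n) K}
    {N : Matrix m (Fin n) K} (hM : Fits A M) (hN : Fits C N) :
    ∃ f, IsLinking (obsEdge A C) f ∧ (obsMat M N).rank ≤ linkSize (obsEdge A C) f := by
  classical
  let M' : Matrix (Fin n) (Fin n) K := fun j i => if Reaches A C j then M j i else 0
  -- Columns of `N * M ^ k` at states that reach no output are zero, so the edges into such states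
  -- may be deleted.
  have hsupp : ∀ k : ℕ, N * M ^ k = N * M' ^ k ∧
      ∀ y j, ¬ Reaches A C j → (N * M ^ k) y j = 0 := by
    intro k
    induction k with
    | zero =>
      refine ⟨by simp, fun y j hj => ?_⟩
      rw [pow_zero, Matrix.mul_one]
      by_contra h
      exact hj ⟨j, y, Relation.ReflTransGen.refl, hN y j h⟩
    | succ k ih =>
      constructor
      · rw [pow_succ, pow_succ, ← Matrix.mul_assoc, ← Matrix.mul_assoc, ← ih.1]
        ext y i
        rw [Matrix.mul_apply, Matrix.mul_apply]
        refine Finset.sum_congr rfl fun j _ => ?_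
        by_cases hj : Reaches A C j
        · simp [M', hj]
        · rw [ih.2 y j hj, zero_mul, zero_mul]
      · intro y i hi
        rw [pow_succ, ← Matrix.mul_assoc, Matrix.mul_apply]
        refine Finset.sum_eq_zero fun j _ => ?_
        by_cases hj : Reaches A C j
        · by_cases h0 : M j i = 0
          · rw [h0, mul_zero]
          · obtain ⟨k', y', hk', hy'⟩ := hj
            exact absurd ⟨k', y', Relation.ReflTransGen.head (hM j i h0) hk', hy'⟩ hi
        · rw [ih.2 y j hj, zero_mul]
  have hobs : obsMat M N = obsMat M' N := by
    ext ⟨k, y⟩ j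
    exact congrFun (congrFun (hsupp k).1 y) j
  obtain ⟨f, hf, hr⟩ := exists_linking_rank_le M' N
  have hE : ∀ v i, Matrix.fromRows M' N v i ≠ 0 → obsEdge A C v i := by
    rintro (j | y) i h
    · have h1 : M' j i ≠ 0 := h
      by_cases hj : Reaches A C j
      · exact ⟨hM j i (by simpa [M', hj] using h1), hj⟩
      · simp [M', hj] at h1
    · exact hN y i h
  exact ⟨f, hf.mono hE, (hobs ▸ hr).trans (linkSize_mono fun i => hE _ i)⟩

/-- The forest realization and the closed-up linking are different realizations, but each gives a
rank bound that holds generically, so one realization satisfies both. The first bound makes `M`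
nilpotent on the unobservable subspace; the second then limits the dimension of that subspace. -/
theorem exists_rank_obsMat_ge_of_reaches (hreach : ∀ j i, A j i = true → Reaches A C j)
    {f : Fin n → Fin n ⊕ m} (hf : IsLinking (fun v i => Matrix.fromRows A C v i = true) f) :
    ∃ (M : Matrix (Fin n) (Fin n) ℝ) (N : Matrix m (Fin n) ℝ), Fits A M ∧ Fits C N ∧
      linkSize (fun v i => Matrix.fromRows A C v i = true) f ≤ (obsMat M N).rank := by
  classical
  obtain ⟨σ, hσ, hmax⟩ := Finset.exists_max_image
    (Finset.univ.filter fun σ : Equiv.Perm (Fin n) => ∀ i, A (σ i) i = true ∨ σ i = i)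
    (fun σ => (Finset.univ.filter fun i => A (σ i) i = true).card)
    ⟨1, by simp⟩
  rw [Finset.mem_filter] at hσ
  obtain ⟨M₁, N₁, hM₁, hN₁, h₁⟩ := exists_card_le_rank_obsMat_mul_pow hσ.2 hreach
  obtain ⟨G, M₂, N₂, hM₂, hN₂, h₂⟩ := exists_gain_linkSize_le hf
  have g₁ := genericPair_le_rank (fun {R} _ _ M N => obsMat M N * M ^ n)
    (fun g M N => by
      rw [← AlgHom.coe_toRingHom, Matrix.map_mul, obsMat_map, Matrix.map_pow]) hM₁ hN₁ h₁
  have g₂ := genericPair_le_rank (A := A) (C := C) (M₀ := M₂) (N₀ := N₂)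
    (fun {R} _ _ M N => (M + G.map (algebraMap ℝ R) * N) ^ n)
    (fun {R R'} _ _ _ _ g M N => by
      rw [← AlgHom.coe_toRingHom, Matrix.map_pow, Matrix.map_add _ (map_add _), Matrix.map_mul]
      congr 3
      ext i j
      simp) hM₂ hN₂ (by simpa using h₂)
  obtain ⟨M, N, hM, hN, h1, h2⟩ := (g₁.and g₂).exists
  refine ⟨M, N, hM, hN, ?_⟩
  -- `σ` covers the most states by cycles, so its count bounds the rank of `M ^ n`, and by
  -- genericity it is at most the rank of `obsMat M N * M ^ n`. The kernels of these two matrices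
  -- then coincide.
  have hpow : (M ^ n).rank ≤ (obsMat M N * M ^ n).rank := by
    obtain ⟨τ, hτ, hr⟩ := exists_perm_rank_pow_le M
    refine (hr.trans ((Finset.card_le_card fun i hi => ?_).trans (hmax τ ?_))).trans h1
    · rw [Finset.mem_filter] at hi ⊢
      exact ⟨hi.1, hM _ _ hi.2⟩
    · rw [Finset.mem_filter]
      exact ⟨Finset.mem_univ _, fun i => (hτ i).imp_left (hM _ _)⟩
  have hker : LinearMap.ker (M ^ n).mulVecLin = LinearMap.ker (obsMat M N * M ^ n).mulVecLin := by
    refine Submodule.eq_of_le_of_finrank_le (fun v hv => ?_) ?_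
    · rw [LinearMap.mem_ker, Matrix.mulVecLin_apply] at hv ⊢
      rw [← Matrix.mulVec_mulVec, hv, Matrix.mulVec_zero]
    · have e1 := LinearMap.finrank_range_add_finrank_ker (M ^ n).mulVecLin
      have e2 := LinearMap.finrank_range_add_finrank_ker (obsMat M N * M ^ n).mulVecLin
      unfold Matrix.rank at hpow
      omega
  have hnil : ∀ v ∈ unobs M N, M ^ n *ᵥ v = 0 := by
    intro v hv
    have h3 : v ∈ LinearMap.ker (obsMat M N * M ^ n).mulVecLin := by
      rw [LinearMap.mem_ker, Matrix.mulVecLin_apply, ← Matrix.mulVec_mulVec]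
      have h4 := pow_mulVec_mem_unobs hv n
      rw [← ker_obsMat] at h4
      exact h4
    rw [← hker] at h3
    exact h3
  -- `N` vanishes along the orbit of an unobservable vector, so the output injection has no effect
  -- on it.
  have hle : unobs M N ≤ LinearMap.ker ((M + G.map (algebraMap ℝ ℝ) * N) ^ n).mulVecLin := by
    intro v hv
    have hk : ∀ k : ℕ, (M + G.map (algebraMap ℝ ℝ) * N) ^ k *ᵥ v = M ^ k *ᵥ v := by
      intro k
      induction k with
      | zero => simp
      | succ k ih =>
        rw [pow_succ', pow_succ', ← Matrix.mulVec_mulVec, ih, Matrix.add_mulVec,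
          ← Matrix.mulVec_mulVec (M ^ k *ᵥ v) _ N,
          mulVec_eq_zero_of_mem_unobs (pow_mulVec_mem_unobs hv k), Matrix.mulVec_zero, add_zero,
          Matrix.mulVec_mulVec]
    rw [LinearMap.mem_ker, Matrix.mulVecLin_apply, hk, hnil v hv]
  have e1 := LinearMap.finrank_range_add_finrank_ker
    ((M + G.map (algebraMap ℝ ℝ) * N) ^ n).mulVecLin
  have e2 := Submodule.finrank_mono hle
  have e3 := rank_obsMat M N
  rw [Module.finrank_fin_fun] at e1
  unfold Matrix.rank at h2
  omega

/-- The generic rank is at least the size of each linking. -/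
theorem linkSize_le_grankObs {f : Fin n → Fin n ⊕ m} (hf : IsLinking (obsEdge A C) f) :
    linkSize (obsEdge A C) f ≤ grankObs A C := by
  classical
  let A' : StructMat (Fin n) (Fin n) := fun j i => A j i && decide (Reaches A C j)
  have hA' : ∀ j i, A' j i = true ↔ A j i = true ∧ Reaches A C j := by simp [A']
  have hreach : ∀ j, Reaches A C j → Reaches A' C j := by
    rintro j ⟨k, y, hjk, hy⟩
    refine ⟨k, y, ?_, hy⟩
    induction hjk using Relation.ReflTransGen.head_induction_on with
    | refl => exact Relation.ReflTransGen.refl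
    | head hab hbk ih => exact Relation.ReflTransGen.head ((hA' _ _).2 ⟨hab, k, y, hbk, hy⟩) ih
  have hE : ∀ v i, obsEdge A C v i ↔ Matrix.fromRows A' C v i = true := by
    rintro (j | y) i
    · exact (hA' j i).symm
    · exact Iff.rfl
  obtain ⟨M, N, hM, hN, h⟩ := exists_rank_obsMat_ge_of_reaches (A := A') (C := C)
    (fun j i hji => hreach j ((hA' j i).1 hji).2) (hf.mono fun v i => (hE v i).1)
  exact (linkSize_mono fun i => (hE _ i).1).trans (h.trans
    (rank_le_grankObs (fun j i hji => ((hA' j i).1 (hM j i hji)).1) hN))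

theorem exists_linking_grankObs_le (A : StructMat (Fin n) (Fin n)) (C : StructMat m (Fin n)) :
    ∃ f, IsLinking (obsEdge A C) f ∧ grankObs A C ≤ linkSize (obsEdge A C) f := by
  obtain ⟨M, N, hM, hN, h⟩ := exists_rank_eq_grankObs A C
  rw [← h]
  exact exists_obsEdge_linking_rank_le hM hN

end

/-! Perfect matchings of the augmented bipartite graph and linkings -/

theorem outputReachable_iff_reaches {n : ℕ} {m : Type} {A : StructMat (Fin n) (Fin n)}
    {C : StructMat m (Fin n)} {j : Fin n} : OutputReachable A C j ↔ Reaches A C j := by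
  constructor
  · rintro ⟨y, h⟩
    have key : ∀ v, Relation.ReflTransGen (sysEdge A C) v (Sum.inr y) →
        ∀ i, v = Sum.inl i → Reaches A C i := by
      intro v hv
      induction hv using Relation.ReflTransGen.head_induction_on with
      | refl => intro i hi; simp at hi
      | @head a b hab _ ih =>
        rintro i rfl
        rcases b with k | z
        · obtain ⟨k', y', hk', hy'⟩ := ih k rfl
          exact ⟨k', y', Relation.ReflTransGen.head hab hk', hy'⟩
        · exact ⟨i, z, Relation.ReflTransGen.refl, hab⟩
    exact key _ h j rfl
  · rintro ⟨k, y, hjk, hy⟩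
    refine ⟨y, Relation.ReflTransGen.tail (b := Sum.inl k) ?_ hy⟩
    exact Relation.ReflTransGen.lift (p := sysEdge A C) Sum.inl (fun _ _ h => h) _ _ hjk

section matching
variable {n : ℕ} {A : StructMat (Fin n) (Fin n)} {S : Finset (Fin n)}

theorem structIdOn_eq_true {y : {i // i ∈ S}} {i : Fin n} :
    structIdOn S y i = true ↔ (y : Fin n) = i := by simp [structIdOn]

/-- The matching given by a permutation. -/
def permGraph {V : Type} [Fintype V] [DecidableEq V] (τ : Equiv.Perm V) : Finset (V × V) :=
  Finset.univ.image fun v => (v, τ v)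

theorem mem_permGraph {V : Type} [Fintype V] [DecidableEq V] {τ : Equiv.Perm V} {e : V × V} :
    e ∈ permGraph τ ↔ τ e.1 = e.2 := by
  simp only [permGraph, Finset.mem_image, Finset.mem_univ, true_and]
  constructor
  · rintro ⟨v, rfl⟩
    rfl
  · intro h
    exact ⟨e.1, Prod.ext rfl h⟩

theorem card_permGraph {V : Type} [Fintype V] [DecidableEq V] (τ : Equiv.Perm V) :
    (permGraph τ).card = Fintype.card V :=
  Finset.card_image_of_injective _ fun _ _ h => congrArg Prod.fst h

theorem sum_permGraph {V : Type} [Fintype V] [DecidableEq V] (τ : Equiv.Perm V) (w : V × V → ℕ) :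
    ∑ e ∈ permGraph τ, w e = ∑ v, w (v, τ v) :=
  Finset.sum_image fun _ _ _ _ h => congrArg Prod.fst h

theorem isMatching_permGraph {V : Type} [Fintype V] [DecidableEq V] {E : V → V → Prop}
    {τ : Equiv.Perm V} (h : ∀ v, E v (τ v)) : IsMatching E (permGraph τ) := by
  refine ⟨fun e he => mem_permGraph.1 he ▸ h e.1, fun e he e' he' hee' => ?_⟩
  rw [mem_permGraph] at he he'
  have h1 : e.1 = e'.1 := hee'.elim id fun h2 => τ.injective (by rw [he, he', h2])
  exact Prod.ext h1 (by rw [← he, ← he', h1])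

theorem IsMatching.card_le {V : Type} [Fintype V] {E : V → V → Prop} {H : Finset (V × V)}
    (h : IsMatching E H) : H.card ≤ Fintype.card V :=
  Finset.card_le_card_of_injOn Prod.fst (fun _ _ => Finset.mem_univ _)
    fun e he e' he' hee' => h.2 e he e' he' (Or.inl hee')

theorem isMaximumMatching_permGraph {V : Type} [Fintype V] [DecidableEq V] {E : V → V → Prop}
    {τ : Equiv.Perm V} (h : ∀ v, E v (τ v)) : IsMaximumMatching E (permGraph τ) :=
  ⟨isMatching_permGraph h, fun _ hH' => (card_permGraph τ).symm ▸ hH'.card_le⟩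

/-- In a graph with a loop at each vertex, the maximum matchings are permutations. -/
theorem IsMaximumMatching.exists_perm {V : Type} [Fintype V] [DecidableEq V] {E : V → V → Prop}
    (hloop : ∀ v, E v v) {H : Finset (V × V)} (h : IsMaximumMatching E H) :
    ∃ τ : Equiv.Perm V, (∀ v, E v (τ v)) ∧ H = permGraph τ := by
  have hcard : H.card = Fintype.card V := by
    refine le_antisymm h.1.card_le ?_
    rw [← card_permGraph (1 : Equiv.Perm V)]
    exact h.2 _ (isMatching_permGraph hloop)
  have himg : H.image Prod.fst = Finset.univ := by
    rw [← Finset.card_eq_iff_eq_univ, ← hcard]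
    exact Finset.card_image_of_injOn fun e he e' he' hee' => h.1.2 e he e' he' (Or.inl hee')
  have hex : ∀ v, ∃ w, (v, w) ∈ H := by
    intro v
    obtain ⟨⟨a, b⟩, he, hv⟩ := Finset.mem_image.1 (himg ▸ Finset.mem_univ v)
    exact ⟨b, hv ▸ he⟩
  choose t ht using hex
  have hinj : Function.Injective t := fun v w hvw =>
    congrArg Prod.fst (h.1.2 _ (ht v) _ (ht w) (Or.inr hvw))
  refine ⟨Equiv.ofBijective t (Finite.injective_iff_bijective.1 hinj),
    fun v => h.1.1 _ (ht v), ?_⟩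
  symm
  refine Finset.eq_of_subset_of_card_le (fun e he => ?_) (by rw [card_permGraph, hcard])
  rw [mem_permGraph, Equiv.ofBijective_apply] at he
  have := ht e.1
  rwa [he] at this

/-- The number of states that a linking joins to outputs. -/
def outCount {m : Type} (f : Fin n → Fin n ⊕ m) : ℕ :=
  (Finset.univ.filter fun i => (f i).isRight).card

theorem outCount_le_card {m : Type} [Fintype m] {f : Fin n → Fin n ⊕ m}
    (hf : Function.Injective f) : outCount f ≤ Fintype.card m := by
  classical
  have h := Finset.card_le_card_of_injOn (s := Finset.univ.filter fun i => (f i).isRight)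
    (t := Finset.univ.image (Sum.inr : m → Fin n ⊕ m)) f (fun i hi => by
      obtain ⟨y, hy⟩ := Sum.isRight_iff.1 (Finset.mem_filter.1 hi).2
      rw [hy]
      exact Finset.mem_coe.2 (Finset.mem_image_of_mem _ (Finset.mem_univ y))) hf.injOn
  exact h.trans (Finset.card_image_le.trans Finset.card_univ.le)

/-- The weight of a linking. -/
def linkWeight (A : StructMat (Fin n) (Fin n)) (S : Finset (Fin n))
    (f : Fin n → Fin n ⊕ {i // i ∈ S}) : ℕ := ∑ i, augCost A S (Sum.inl i, f i)

open Classical in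
theorem augCost_inl (v : AugVertex S) (i : Fin n) (hv : v.isRight → obsEdge A (structIdOn S) v i) :
    augCost A S (Sum.inl i, v) + (if v.isRight then 1 else 0) =
      if obsEdge A (structIdOn S) v i then S.card + 1 else 0 := by
  rcases v with j | y
  · have h : (A j i = true ∧ OutputReachable A (structIdOn S) j) ↔
        obsEdge A (structIdOn S) (Sum.inl j) i := and_congr_right' outputReachable_iff_reaches
    simp only [augCost, h, Sum.isRight_inl, Bool.false_eq_true, if_false, add_zero]
  · have h : structIdOn S y i = true := hv rfl
    have h' : obsEdge A (structIdOn S) (Sum.inr y) i := h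
    simp only [augCost, h, h', Sum.isRight_inr, if_true]

/-- Every covering edge is worth `q + 1`, less one if it ends in an output; weight thus orders
linkings first by size and then by thrift in outputs. -/
theorem linkWeight_add_outCount {f : Fin n → Fin n ⊕ {i // i ∈ S}}
    (hf : IsLinking (obsEdge A (structIdOn S)) f) :
    linkWeight A S f + outCount f = (S.card + 1) * linkSize (obsEdge A (structIdOn S)) f := by
  classical
  unfold linkWeight outCount linkSize
  rw [Finset.card_filter, ← Finset.sum_add_distrib, Finset.card_filter, Finset.mul_sum]
  refine Finset.sum_congr rfl fun i _ => ?_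
  rw [mul_ite, mul_one, mul_zero]
  convert augCost_inl (f i) i ?_ using 2
  intro h
  refine (hf.2 i).resolve_right fun h' => ?_
  rw [h'] at h
  simp at h

theorem sum_augCost_permGraph (τ : Equiv.Perm (AugVertex S)) :
    ∑ e ∈ permGraph τ, augCost A S e = linkWeight A S fun i => τ (Sum.inl i) := by
  rw [sum_permGraph, Fintype.sum_sum_type]
  have : ∀ y : {i // i ∈ S}, augCost A S (Sum.inr y, τ (Sum.inr y)) = 0 := fun y => rfl
  simp [this, linkWeight]

theorem exists_perm_of_linking {f : Fin n → Fin n ⊕ {i // i ∈ S}}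
    (hf : IsLinking (obsEdge A (structIdOn S)) f) :
    ∃ τ : Equiv.Perm (AugVertex S), (∀ v, augEdge A S v (τ v)) ∧ ∀ i, τ (Sum.inl i) = f i := by
  obtain ⟨τ, hτ, hτ'⟩ := exists_perm_extending f hf.1
  refine ⟨τ, ?_, hτ⟩
  rintro (i | y)
  · rw [hτ]
    rcases hf.2 i with h | h
    · left
      rcases hfi : f i with j | y
      · rw [hfi] at h
        exact h.1
      · rw [hfi] at h
        exact h
    · exact Or.inr (Or.inl h.symm)
  · rcases hτ' y with ⟨i, hi⟩ | h
    · exact Or.inr (Or.inr ⟨y, i, rfl, hi⟩)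
    · exact Or.inr (Or.inl h.symm)

/-- States that reach no output have edges only to each other, so the permutation maps this finite
set onto itself. Replacing it there by the identity keeps injectivity and loses no weight, since
edges into such states cost `0`. -/
theorem exists_linking_of_perm {τ : Equiv.Perm (AugVertex S)} (hτ : ∀ v, augEdge A S v (τ v)) :
    ∃ f, IsLinking (obsEdge A (structIdOn S)) f ∧
      linkWeight A S f = linkWeight A S (fun i => τ (Sum.inl i)) ∧
      ∀ i y, f i = Sum.inr y ↔ τ (Sum.inl i) = Sum.inr y := by
  classical
  let P : AugVertex S → Prop := fun v => ∃ i, v = Sum.inl i ∧ ¬ Reaches A (structIdOn S) i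
  have hout : ∀ i y, τ (Sum.inl i) = Sum.inr y → structIdOn S y i = true := by
    intro i y h
    have h1 := hτ (Sum.inl i)
    rw [h] at h1
    rcases h1 with h1 | h1 | ⟨_, _, h1, _⟩
    · exact h1
    · simp at h1
    · simp at h1
  have hin : ∀ i j, τ (Sum.inl i) = Sum.inl j → A j i = true ∨ i = j := by
    intro i j h
    have h1 := hτ (Sum.inl i)
    rw [h] at h1
    rcases h1 with h1 | h1 | ⟨_, _, h1, _⟩
    · exact Or.inl h1
    · exact Or.inr (Sum.inl_injective h1)
    · simp at h1
  have hstep : ∀ i j, A j i = true → Reaches A (structIdOn S) j → Reaches A (structIdOn S) i :=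
    fun i j hij ⟨k, y, hk, hy⟩ => ⟨k, y, Relation.ReflTransGen.head hij hk, hy⟩
  have hP : ∀ v, P v → P (τ v) := by
    rintro v ⟨i, rfl, hi⟩
    rcases h : τ (Sum.inl i) with j | y
    · refine ⟨j, rfl, fun hj => hi ?_⟩
      rcases hin i j h with h1 | rfl
      · exact hstep i j h1 hj
      · exact hj
    · exact absurd ⟨i, y, Relation.ReflTransGen.refl, hout i y h⟩ hi
  have hP' : ∀ v, P (τ v) → P v := by
    have hmaps : Finset.image τ (Finset.univ.filter P) = Finset.univ.filter P := by
      refine Finset.eq_of_subset_of_card_le (fun w hw => ?_)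
        (Finset.card_image_of_injective _ τ.injective).ge
      obtain ⟨v, hv, rfl⟩ := Finset.mem_image.1 hw
      exact Finset.mem_filter.2 ⟨Finset.mem_univ _, hP v (Finset.mem_filter.1 hv).2⟩
    intro v hv
    have h1 : τ v ∈ Finset.univ.filter P := Finset.mem_filter.2 ⟨Finset.mem_univ _, hv⟩
    rw [← hmaps] at h1
    obtain ⟨w, hw, hwv⟩ := Finset.mem_image.1 h1
    exact τ.injective hwv ▸ (Finset.mem_filter.1 hw).2
  let f : Fin n → AugVertex S := fun i =>
    if Reaches A (structIdOn S) i then τ (Sum.inl i) else Sum.inl i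
  have hft : ∀ i, Reaches A (structIdOn S) i → f i = τ (Sum.inl i) := fun i hi => if_pos hi
  have hff : ∀ i, ¬ Reaches A (structIdOn S) i → f i = Sum.inl i := fun i hi => if_neg hi
  have hreach : ∀ i, Reaches A (structIdOn S) i → ¬ P (τ (Sum.inl i)) := by
    intro i hi h
    obtain ⟨j, hj, hj'⟩ := hP' _ h
    exact hj' (Sum.inl_injective hj ▸ hi)
  refine ⟨f, ⟨?_, fun i => ?_⟩, ?_, fun i y => ?_⟩
  · intro i j hij
    by_cases hi : Reaches A (structIdOn S) i <;> by_cases hj : Reaches A (structIdOn S) j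
    · rw [hft i hi, hft j hj] at hij
      exact Sum.inl_injective (τ.injective hij)
    · rw [hft i hi, hff j hj] at hij
      exact absurd ⟨j, hij, hj⟩ (hreach i hi)
    · rw [hff i hi, hft j hj] at hij
      exact absurd ⟨i, hij.symm, hi⟩ (hreach j hj)
    · rw [hff i hi, hff j hj] at hij
      exact Sum.inl_injective hij
  · by_cases hi : Reaches A (structIdOn S) i
    · rw [hft i hi]
      rcases h : τ (Sum.inl i) with j | y
      · have hj : Reaches A (structIdOn S) j := by
          by_contra hj
          exact hreach i hi ⟨j, h, hj⟩
        rcases hin i j h with h1 | rfl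
        · exact Or.inl ⟨h1, hj⟩
        · exact Or.inr rfl
      · exact Or.inl (hout i y h)
    · exact Or.inr (hff i hi)
  · unfold linkWeight
    refine Finset.sum_congr rfl fun i _ => ?_
    change augCost A S (Sum.inl i, f i) = augCost A S (Sum.inl i, τ (Sum.inl i))
    by_cases hi : Reaches A (structIdOn S) i
    · rw [hft i hi]
    · obtain ⟨j, hj, hj'⟩ := hP _ ⟨i, rfl, hi⟩
      rw [hff i hi, hj]
      simp [augCost, outputReachable_iff_reaches, hi, hj']
  · by_cases hi : Reaches A (structIdOn S) i
    · rw [hft i hi]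
    · rw [hff i hi]
      refine ⟨fun h => by simp at h, fun h => absurd ?_ hi⟩
      exact ⟨i, y, Relation.ReflTransGen.refl, hout i y h⟩

/-- A maximum weight maximum matching gives a linking of the largest size that uses the fewest
outputs. -/
theorem IsMaxWeightMaximumMatching.exists_linking
    {H : Finset (AugVertex S × AugVertex S)}
    (h : IsMaxWeightMaximumMatching (augEdge A S) (augCost A S) H) :
    ∃ f, IsLinking (obsEdge A (structIdOn S)) f ∧
      (∀ i, i ∈ matchedToOutput H ↔ (f i).isRight) ∧
      (matchedToOutput H).card = outCount f ∧
      ∀ f', IsLinking (obsEdge A (structIdOn S)) f' →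
        linkSize (obsEdge A (structIdOn S)) f' ≤ linkSize (obsEdge A (structIdOn S)) f ∧
        (linkSize (obsEdge A (structIdOn S)) f ≤ linkSize (obsEdge A (structIdOn S)) f' →
          outCount f ≤ outCount f') := by
  obtain ⟨τ, hτ, rfl⟩ := IsMaximumMatching.exists_perm
    (E := augEdge A S) (fun v => Or.inr (Or.inl rfl)) h.1
  obtain ⟨f, hf, hw, hfy⟩ := exists_linking_of_perm hτ
  have hmem : ∀ i, i ∈ matchedToOutput (permGraph τ) ↔ (f i).isRight := by
    intro i
    rw [Sum.isRight_iff, matchedToOutput, Finset.mem_filter]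
    simp only [Finset.mem_univ, true_and, mem_permGraph, hfy]
  refine ⟨f, hf, hmem, ?_, fun f' hf' => ?_⟩
  · unfold outCount
    congr 1
    ext i
    rw [hmem, Finset.mem_filter]
    simp
  · obtain ⟨τ', hτ', hf'τ⟩ := exists_perm_of_linking hf'
    have h1 := h.2 _ (isMaximumMatching_permGraph hτ')
    rw [sum_augCost_permGraph, sum_augCost_permGraph, ← hw] at h1
    have h2 : (fun i => τ' (Sum.inl i)) = f' := funext hf'τ
    rw [h2] at h1
    have e1 := linkWeight_add_outCount hf
    have e2 := linkWeight_add_outCount hf'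
    -- A larger linking gains at least `q + 1` from its size and loses at most `q` for its outputs,
    -- so it would have a larger weight.
    have e3 : outCount f' ≤ S.card := by simpa using outCount_le_card hf'.1
    constructor
    · by_contra! hlt
      have := Nat.mul_le_mul_left (S.card + 1) hlt
      rw [Nat.succ_eq_add_one, mul_add, mul_one] at this
      omega
    · intro hle
      have := Nat.mul_le_mul_left (S.card + 1) hle
      omega

theorem exists_linking_of_nonempty (hS : S.Nonempty) :
    ∃ f, IsLinking (obsEdge A (structIdOn S)) f ∧ 0 < linkSize (obsEdge A (structIdOn S)) f := by
  classical
  obtain ⟨i₀, hi₀⟩ := hS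
  let f : Fin n → Fin n ⊕ {i // i ∈ S} := fun i =>
    if i = i₀ then Sum.inr ⟨i₀, hi₀⟩ else Sum.inl i
  have h₀ : f i₀ = Sum.inr ⟨i₀, hi₀⟩ := if_pos rfl
  have h₁ : ∀ i, i ≠ i₀ → f i = Sum.inl i := fun i hi => if_neg hi
  have hE : obsEdge A (structIdOn S) (f i₀) i₀ := by
    rw [h₀]
    exact structIdOn_eq_true.2 rfl
  refine ⟨f, ⟨fun i j hij => ?_, fun i => ?_⟩, Finset.card_pos.2 ⟨i₀, ?_⟩⟩
  · by_cases hi : i = i₀ <;> by_cases hj : j = i₀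
    · rw [hi, hj]
    · rw [hi, h₀, h₁ j hj] at hij
      simp at hij
    · rw [hj, h₀, h₁ i hi] at hij
      simp at hij
    · rw [h₁ i hi, h₁ j hj] at hij
      exact Sum.inl_injective hij
  · by_cases hi : i = i₀
    · exact Or.inl (hi ▸ hE)
    · exact Or.inr (h₁ i hi)
  · simpa using hE

end matching

/-! The matching based algorithm -/

section algorithm
variable {n r : ℕ} {A : StructMat (Fin n) (Fin n)} {F : StructMat (Fin r) (Fin n)}

/-- The maximum matchings form a finite set, nonempty because all loops together are one of them.
Row `0` exists as `γ ≥ 1`, and can serve for all extra entries. -/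
theorem exists_matchingReturns (A : StructMat (Fin n) (Fin n)) (F : StructMat (Fin r) (Fin n)) :
    ∃ (p : ℕ) (C : StructMat (Fin p) (Fin n)), MatchingReturns A F C := by
  classical
  set S := nonzeroCols F
  obtain ⟨H, hH, hmax⟩ := Finset.exists_max_image
    (Finset.univ.filter fun H => IsMaximumMatching (augEdge A S) H)
    (fun H => ∑ e ∈ H, augCost A S e)
    ⟨permGraph 1, Finset.mem_filter.2 ⟨Finset.mem_univ _,
      isMaximumMatching_permGraph fun v => Or.inr (Or.inl rfl)⟩⟩
  refine ⟨max 1 (matchedToOutput H).card,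
    fun k j => decide ((∃ l : Fin (matchedToOutput H).card,
      (l : ℕ) = (k : ℕ) ∧ ((matchedToOutput H).equivFin.symm l : Fin n) = j) ∨
        (j ∈ S ∧ j ∉ matchedToOutput H ∧ (∀ i ∈ matchedToOutput H, ¬ StateReach A j i) ∧
          (⟨0, by omega⟩ : Fin (max 1 (matchedToOutput H).card)) = k)),
    H, ⟨(Finset.mem_filter.1 hH).2, fun H' hH' =>
      hmax H' (Finset.mem_filter.2 ⟨Finset.mem_univ _, hH'⟩)⟩, rfl,
    (matchedToOutput H).equivFin.symm, fun _ => ⟨0, by omega⟩, fun k j => ?_⟩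
  rw [decide_eq_true_iff]

/-- Each state of `X_H` has a row of its own, so the optimal linking carries over to `C` and `C`
attains the full generic rank. Conversely, a linking for a feasible `C'` that attains the rank uses
at most `p'` rows and becomes a linking of the largest size into the separate outputs, so it uses at
least `|X_H|` of them. -/
theorem MatchingReturns.isConstrainedOptimal (hF : (nonzeroCols F).Nonempty) {p : ℕ}
    {C : StructMat (Fin p) (Fin n)} (h : MatchingReturns A F C) : IsConstrainedOptimal A F C := by
  classical
  obtain ⟨H, hH, hp, e, c, hC⟩ := h
  obtain ⟨f, hf, hmem, hcard, hopt⟩ := hH.exists_linking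
  have hout : ∀ i y, f i = Sum.inr y → (y : Fin n) = i := by
    intro i y hi
    have h1 := (hf.2 i).resolve_right (by rw [hi]; simp)
    rw [hi] at h1
    exact structIdOn_eq_true.1 h1
  have hgrank : grankObs A (structIdOn (nonzeroCols F)) = linkSize (obsEdge A (structIdOn (nonzeroCols F))) f := by
    refine le_antisymm ?_ (linkSize_le_grankObs hf)
    obtain ⟨f', hf', hle⟩ := exists_linking_grankObs_le A (structIdOn (nonzeroCols F))
    exact hle.trans (hopt f' hf').1
  have hsub : nonzeroCols C ⊆ nonzeroCols F := by
    intro j hj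
    obtain ⟨k, hk⟩ := mem_nonzeroCols.1 hj
    rcases (hC k j).1 hk with ⟨l, -, rfl⟩ | h1
    · obtain ⟨y, hy⟩ := Sum.isRight_iff.1 ((hmem _).1 (e l).2)
      exact hout _ y hy ▸ y.2
    · exact h1.1
  have hrow : ∀ i, i ∈ matchedToOutput H → ∃ k : Fin p, C k i = true ∧
      ∃ hi : i ∈ matchedToOutput H, (k : ℕ) = (e.symm ⟨i, hi⟩ : ℕ) := by
    intro i hi
    have hlt : (e.symm ⟨i, hi⟩ : ℕ) < p := by
      have := (e.symm ⟨i, hi⟩).2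
      omega
    refine ⟨⟨_, hlt⟩, (hC _ _).2 (Or.inl ⟨e.symm ⟨i, hi⟩, rfl, ?_⟩), hi, rfl⟩
    rw [Equiv.apply_symm_apply]
  -- The extra entries serve only here: a functional state that reaches no element of `X_H` is read
  -- directly, so output reachability is the same for `C` as for all functional states.
  have hreach : ∀ j, Reaches A (structIdOn (nonzeroCols F)) j → Reaches A C j := by
    rintro j ⟨k, y, hjk, hy⟩
    have hkS : k ∈ (nonzeroCols F) := structIdOn_eq_true.1 hy ▸ y.2
    by_cases hk : k ∈ matchedToOutput H
    · obtain ⟨l, hl, -⟩ := hrow k hk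
      exact ⟨k, l, hjk, hl⟩
    by_cases hex : ∃ i ∈ matchedToOutput H, StateReach A k i
    · obtain ⟨i, hi, hki⟩ := hex
      obtain ⟨l, hl, -⟩ := hrow i hi
      exact ⟨i, l, hjk.trans hki, hl⟩
    · push Not at hex
      exact ⟨k, c k, hjk, (hC _ _).2 (Or.inr ⟨hkS, hk, hex, rfl⟩)⟩
  refine ⟨?_, hsub, fun p' C' hSFO' hC' => ?_⟩
  · rw [isSFO_iff_grankObs hsub, hgrank]
    have hg : ∀ i, ∃ v : Fin n ⊕ Fin p, (∀ j, f i = Sum.inl j → v = Sum.inl j) ∧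
        ((f i).isRight → ∃ k : Fin p, v = Sum.inr k ∧ C k i = true ∧
          ∃ hi : i ∈ matchedToOutput H, (k : ℕ) = (e.symm ⟨i, hi⟩ : ℕ)) := by
      intro i
      rcases hfi : f i with j | y
      · exact ⟨Sum.inl j, fun j' hj' => by rw [Sum.inl_injective hj'], fun h => by simp at h⟩
      · obtain ⟨k, hk⟩ := hrow i ((hmem i).2 (by rw [hfi]; rfl))
        exact ⟨Sum.inr k, fun j hj => by simp at hj, fun _ => ⟨k, rfl, hk⟩⟩
    choose g hgl hgr using hg
    have hglink : IsLinking (obsEdge A C) g ∧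
        ∀ i, obsEdge A (structIdOn (nonzeroCols F)) (f i) i → obsEdge A C (g i) i := by
      have hedge : ∀ i, obsEdge A (structIdOn (nonzeroCols F)) (f i) i → obsEdge A C (g i) i := by
        intro i hi
        rcases hfi : f i with j | y
        · rw [hgl i j hfi]
          rw [hfi] at hi
          exact ⟨hi.1, hreach j hi.2⟩
        · obtain ⟨k, hk, hk', -⟩ := hgr i (by rw [hfi]; rfl)
          rw [hk]
          exact hk'
      refine ⟨⟨fun i j hij => ?_, fun i => ?_⟩, hedge⟩
      · rcases hfi : f i with a | y <;> rcases hfj : f j with b | z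
        · rw [hgl i a hfi, hgl j b hfj] at hij
          exact hf.1 (by rw [hfi, hfj, Sum.inl_injective hij])
        · obtain ⟨k, hk, -⟩ := hgr j (by rw [hfj]; rfl)
          rw [hgl i a hfi, hk] at hij
          simp at hij
        · obtain ⟨k, hk, -⟩ := hgr i (by rw [hfi]; rfl)
          rw [hgl j b hfj, hk] at hij
          simp at hij
        · obtain ⟨k, hk, -, hi, hki⟩ := hgr i (by rw [hfi]; rfl)
          obtain ⟨l, hl, -, hj, hlj⟩ := hgr j (by rw [hfj]; rfl)
          rw [hk, hl] at hij
          rw [Sum.inr_injective hij, hlj, Fin.val_inj] at hki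
          exact (congrArg Subtype.val (e.symm.injective hki)).symm
      · rcases hf.2 i with h1 | h1
        · exact Or.inl (hedge i h1)
        · exact Or.inr (hgl i i h1)
    exact (linkSize_mono hglink.2).trans (linkSize_le_grankObs hglink.1)
  · rw [isSFO_iff_grankObs hC', hgrank] at hSFO'
    obtain ⟨f', hf', hle⟩ := exists_linking_grankObs_le A C'
    have hmemS : ∀ k i, C' k i = true → i ∈ (nonzeroCols F) := fun k i hk => hC' (mem_nonzeroCols.2 ⟨k, hk⟩)
    have hC'edge : ∀ i k, f' i = Sum.inr k → C' k i = true := by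
      intro i k hi
      have h1 := (hf'.2 i).resolve_right (by rw [hi]; simp)
      rw [hi] at h1
      exact h1
    have hg : ∀ i, ∃ v : Fin n ⊕ {i // i ∈ (nonzeroCols F)}, (∀ j, f' i = Sum.inl j → v = Sum.inl j) ∧
        ((f' i).isRight → ∃ y, v = Sum.inr y ∧ (y : Fin n) = i) := by
      intro i
      rcases hfi : f' i with j | k
      · exact ⟨Sum.inl j, fun j' hj' => by rw [Sum.inl_injective hj'], fun h => by simp at h⟩
      · exact ⟨Sum.inr ⟨i, hmemS k i (hC'edge i k hfi)⟩, fun j hj => by simp at hj,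
          fun _ => ⟨_, rfl, rfl⟩⟩
    choose g hgl hgr using hg
    have hreach' : ∀ j, Reaches A C' j → Reaches A (structIdOn (nonzeroCols F)) j := by
      rintro j ⟨k, y, hjk, hy⟩
      exact ⟨k, ⟨k, hmemS y k hy⟩, hjk, structIdOn_eq_true.2 rfl⟩
    have hedge : ∀ i, obsEdge A C' (f' i) i → obsEdge A (structIdOn (nonzeroCols F)) (g i) i := by
      intro i hi
      rcases hfi : f' i with j | y
      · rw [hgl i j hfi]
        rw [hfi] at hi
        exact ⟨hi.1, hreach' j hi.2⟩
      · obtain ⟨y, hy, hy'⟩ := hgr i (by rw [hfi]; rfl)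
        rw [hy]
        exact structIdOn_eq_true.2 hy'
    have hglink : IsLinking (obsEdge A (structIdOn (nonzeroCols F))) g := by
      refine ⟨fun i j hij => ?_, fun i => ?_⟩
      · rcases hfi : f' i with a | y <;> rcases hfj : f' j with b | z
        · rw [hgl i a hfi, hgl j b hfj] at hij
          exact hf'.1 (by rw [hfi, hfj, Sum.inl_injective hij])
        · obtain ⟨k, hk, -⟩ := hgr j (by rw [hfj]; rfl)
          rw [hgl i a hfi, hk] at hij
          simp at hij
        · obtain ⟨k, hk, -⟩ := hgr i (by rw [hfi]; rfl)
          rw [hgl j b hfj, hk] at hij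
          simp at hij
        · obtain ⟨k, hk, hki⟩ := hgr i (by rw [hfi]; rfl)
          obtain ⟨l, hl, hlj⟩ := hgr j (by rw [hfj]; rfl)
          rw [hk, hl] at hij
          rw [← hki, ← hlj, Sum.inr_injective hij]
      · rcases hf'.2 i with h1 | h1
        · exact Or.inl (hedge i h1)
        · exact Or.inr (hgl i i h1)
    have h1 : outCount f ≤ outCount g :=
      (hopt g hglink).2 ((hSFO'.trans hle).trans (linkSize_mono hedge))
    have h2 : outCount g ≤ outCount f' := by
      refine Finset.card_le_card fun i hi => ?_
      rw [Finset.mem_filter] at hi ⊢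
      refine ⟨hi.1, ?_⟩
      rcases hfi : f' i with j | y
      · rw [hgl i j hfi] at hi
        exact hi.2
      · rfl
    have h3 : outCount f' ≤ p' := by simpa using outCount_le_card hf'.1
    -- This accounts for the `1` in `γ`: a functional state read directly already gives positive
    -- generic rank, and a covering edge of `C'` presupposes an output.
    have hpos : 0 < p' := by
      obtain ⟨f₀, hf₀, h4⟩ := exists_linking_of_nonempty (A := A) hF
      have h5 : 0 < linkSize (obsEdge A C') f' :=
        h4.trans_le ((hopt f₀ hf₀).1.trans (hSFO'.trans hle))
      obtain ⟨i, hi⟩ := Finset.card_pos.1 h5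
      simp only [Finset.mem_filter, Finset.mem_univ, true_and] at hi
      rcases hfi : f' i with j | y
      · rw [hfi] at hi
        obtain ⟨-, -, y, -⟩ := hi
        exact y.pos
      · exact y.pos
    omega

end algorithm

end StructSys

end

theorem mainTheorem7 (n r : ℕ) (A : StructSys.StructMat (Fin n) (Fin n))
    (F : StructSys.StructMat (Fin r) (Fin n)) (hF : (StructSys.nonzeroCols F).Nonempty) :
    ((∃ (p : ℕ) (C : StructSys.StructMat (Fin p) (Fin n)), StructSys.IterativeReturns A F C) ∧
      (∃ (p : ℕ) (C : StructSys.StructMat (Fin p) (Fin n)), StructSys.MatchingReturns A F C)) ∧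
    ∀ (p : ℕ) (C : StructSys.StructMat (Fin p) (Fin n)),
      (StructSys.IterativeReturns A F C ∨ StructSys.MatchingReturns A F C) →
        StructSys.IsConstrainedOptimal A F C ∧
        ((StructSys.GenericallyDiagonalizable A ∨
            ∃ h : r = n, F = (StructSys.structId n).submatrix (Fin.cast h) id) →
          StructSys.IsOptimal A F C) := by
  refine ⟨⟨StructSys.exists_iterativeReturns A F, StructSys.exists_matchingReturns A F⟩,
    fun p C h => ?_⟩
  have hopt : StructSys.IsConstrainedOptimal A F C :=
    h.elim (fun h => h.isConstrainedOptimal) fun h => h.isConstrainedOptimal hF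
  refine ⟨hopt, ?_⟩
  rintro (hA | ⟨hr, hId⟩)
  · exact hopt.isOptimal_of_genericallyDiagonalizable hA
  · exact hopt.isOptimal_of_structId hr hId
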